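/- **Setting.** Let $A\in\mathbb R^{m\times n}$ have rank $m$, $b\in\mathbb R^m$, $c\in\mathbb R^n$. Let $\mathcal S$ be the set of triples $(x^*,y^*,s^*)$ such that $x^*$ is optimal for $\min\{c^{\mathsf T}x: Ax=b,\ x\ge 0\}$ and $(y^*,s^*)$ is optimal for $\max\{b^{\mathsf T}y: A^{\mathsf T}y+s=c,\ s\ge0\}$. For $z=(x,y,s)$ put $\mu=x^{\mathsf T}s/n$, $r_p=Ax-b$, $r_d=A^{\mathsf T}y+s-c$, $r=(r_p,r_d)$, $D=\mathrm{diag}(x_i/s_i)^{1/2}$, $X=\mathrm{diag}(x)$, $S=\mathrm{diag}(s)$. For $\gamma\in(0,1)$ and an initial point $z^0=(x^0,y^0,s^0)$ with $\mu_0=(x^0)^{\mathsf T}s^0/n$ and residual $r^0$, let $$\mathcal N(\gamma)=\Big\{(x,y,s): (x,s)>0,\ x_is_i\ge(1-\gamma)\mu\ \text{for all } i,\ \|r\|_2\,\mu_0\le\mu\,\|r^0\|_2\Big\}.$$ **Algorithm** (long-step infeasible IPM; inputs $\gamma\in(0,1)$, $\sigma\in(0,4/5)$, $\epsilon$, $\delta$,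 $t$). While $\mu>\epsilon\mu_0$: (1) Draw a random matrix $W\in\mathbb R^{n\times w}$, independent of the current iterate, which is a sketching matrix with accuracy $\zeta=1/2$ and failure probability $\delta$: for every fixed real matrix $Z$ with $n$ columns, with probability at least $1-\delta$, $$\|ZWW^{\mathsf T}Z^{\mathsf T}-ZZ^{\mathsf T}\|_2\le\tfrac{\zeta}{4}\big(\|Z\|_2^2+\|Z\|_F^2/m\big).$$ (2) Put $Q=(ADW)(ADW)^{\mathsf T}$ and $p=-r_p-\sigma\mu AS^{-1}\mathbf 1+Ax-AD^2r_d$. Run $t$ steps, started at $0$, of conjugate gradients or of Chebyshev iteration with spectral bounds $(1+\zeta/2)^{-1}$ and $(1-\zeta/2)^{-1}$ on $Q^{-1/2}AD^2A^{\mathsf T}Q^{-1/2}\,u=Q^{-1/2}p$, with output $\tilde u^t$. Put $$\Delta y=Q^{-1/2}\tilde u^t,\quad v=(XS)^{1/2}W(ADW)^{\dagger}(AD^2A^{\mathsf T}\Delta y-p),\quad \Delta s=-r_d-A^{\mathsf T}\Delta y,\quad \Delta x=-x+\sigma\mu S^{-1}\mathbf 1-D^2\Delta s-S^{-1}v .$$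 (3) Let $\tilde\alpha\in[0,1]$ be the largest step such that $(x,y,s)+\alpha(\Delta x,\Delta y,\Delta s)\in\mathcal N(\gamma)$ for all $\alpha\in[0,\tilde\alpha]$ (a supremum, if it is not attained). Let $\bar\alpha$ minimize $(x+\alpha\Delta x)^{\mathsf T}(s+\alpha\Delta s)$ over $\alpha\in[0,\tilde\alpha]$, and replace $(x,y,s)$ by $(x,y,s)+\bar\alpha(\Delta x,\Delta y,\Delta s)$. **Theorem.** For every $\Lambda$ there are constants $C,T,c_0>0$, depending only on $\Lambda$, with the following property. Let $\gamma\in(0,1)$ and $\sigma\in(0,4/5)$ satisfy $\max\{\gamma^{-1},(1-\gamma)^{-1},\sigma^{-1},(1-\tfrac54\sigma)^{-1}\}\le\Lambda$. Let the initial point satisfy $(x^0,s^0)>0$, $x^0_is^0_i\ge(1-\gamma)\mu_0$ for all $i$ (that is, $z^0\in\mathcal N(\gamma)$), $(x^0,s^0)\ge(x^*,s^*)$ for some $(x^*,y^*,s^*)\in\mathcal S$, and $s^0\ge|c-A^{\mathsf T}y^0|$ componentwise. Let $0<\epsilon\le1$, let $t\ge T\log(n+1)$ (so that $t=O(\log n)$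 solver steps per iteration suffice), and let $\delta\le c_0/\big(n^2(1+\log(1/\epsilon))\big)$ (so that $\delta$ is of order $n^{-2}$ for fixed $\epsilon$). Then, with probability at least $0.9$, the algorithm, with either solver, converges after $O(n^2\log(1/\epsilon))$ iterations: for every $k\ge C\,n^2\log(1/\epsilon)$, $$\mu_k\le\epsilon\,\mu_0\qquad\text{and}\qquad\|r^k\|_2\le\epsilon\,\|r^0\|_2 ,$$ where the iterate is kept once the loop has ended. -/

import Mathlib

open MeasureTheory ProbabilityTheory Matrix

/-! ### Linear programs in standard form -/

/-- A primal-dual triple `(x, y, s)`. -/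
abbrev Point (m n : ℕ) : Type := (Fin n → ℝ) × (Fin m → ℝ) × (Fin n → ℝ)

/-- The primal variables. -/
def Point.x {m n : ℕ} (z : Point m n) : Fin n → ℝ := z.1

/-- The dual variables. -/
def Point.y {m n : ℕ} (z : Point m n) : Fin m → ℝ := z.2.1

/-- The slack variables. -/
def Point.s {m n : ℕ} (z : Point m n) : Fin n → ℝ := z.2.2

/-- Data of the linear program `min cᵀ x` subject to `A x = b`, `x ≥ 0`. -/
structure LinProg (m n : ℕ) where
  /-- The constraint matrix. -/
  A : Matrix (Fin m) (Fin n) ℝ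
  /-- The right-hand side. -/
  b : Fin m → ℝ
  /-- The cost vector. -/
  c : Fin n → ℝ

namespace LinProg

variable {m n : ℕ}

/-- Feasibility for `min cᵀ x`, `A x = b`, `x ≥ 0`. -/
def PrimalFeasible (L : LinProg m n) (x : Fin n → ℝ) : Prop :=
  L.A *ᵥ x = L.b ∧ ∀ i, 0 ≤ x i

/-- Feasibility for `max bᵀ y`, `Aᵀ y + s = c`, `s ≥ 0`. -/
def DualFeasible (L : LinProg m n) (y : Fin m → ℝ) (s : Fin n → ℝ) : Prop :=
  L.Aᵀ *ᵥ y + s = L.c ∧ ∀ i, 0 ≤ s i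

/-- The set of triples `(x, y, s)` such that `x` is an optimal solution of the primal problem and
`(y, s)` is an optimal solution of the dual problem. -/
def optimalSet (L : LinProg m n) : Set (Point m n) :=
  {z | (L.PrimalFeasible z.x ∧ ∀ x', L.PrimalFeasible x' → L.c ⬝ᵥ z.x ≤ L.c ⬝ᵥ x') ∧
    (L.DualFeasible z.y z.s ∧ ∀ y' s', L.DualFeasible y' s' → L.b ⬝ᵥ y' ≤ L.b ⬝ᵥ z.y)}

/-- The primal residual `A x - b`. -/
def primalRes (L : LinProg m n) (z : Point m n) : Fin m → ℝ := L.A *ᵥ z.x - L.b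

/-- The dual residual `Aᵀ y + s - c`. -/
def dualRes (L : LinProg m n) (z : Point m n) : Fin n → ℝ := L.Aᵀ *ᵥ z.y + z.s - L.c

/-- The Euclidean norm of the residual `r = (r_p, r_d)`, a vector with `m + n` entries. -/
noncomputable def resNorm (L : LinProg m n) (z : Point m n) : ℝ :=
  Real.sqrt ((∑ i, L.primalRes z i ^ 2) + ∑ j, L.dualRes z j ^ 2)

end LinProg

/-- The duality measure `μ = xᵀ s / n`. -/
noncomputable def dualityMeasure {m n : ℕ} (z : Point m n) : ℝ := (z.x ⬝ᵥ z.s) / n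

/-- The infeasible neighbourhood `N(γ)` of the central path, relative to the initial point `z₀`.
The residual condition `‖r‖ / ‖r⁰‖ ≤ μ / μ₀` is written without division, so that it reads `r = 0`
when `r⁰ = 0`. -/
def neighborhood {m n : ℕ} (L : LinProg m n) (γ : ℝ) (z₀ : Point m n) : Set (Point m n) :=
  {z | (∀ i, 0 < z.x i) ∧ (∀ i, 0 < z.s i) ∧
    (∀ i, (1 - γ) * dualityMeasure z ≤ z.x i * z.s i) ∧
    L.resNorm z * dualityMeasure z₀ ≤ dualityMeasure z * L.resNorm z₀}

/-! ### Matrix functions -/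

/-- `U f(Λ) Uᵀ`, where `B Bᵀ = U Λ Uᵀ` is an orthogonal diagonalisation: the columns of `U` are
left singular vectors of `B`, and `Λ` holds the squares of the singular values. -/
noncomputable def gramFun {m w : ℕ} (f : ℝ → ℝ) (B : Matrix (Fin m) (Fin w) ℝ) :
    Matrix (Fin m) (Fin m) ℝ :=
  let h : (B * Bᴴ).IsHermitian := isHermitian_mul_conjTranspose_self B
  let U : Matrix (Fin m) (Fin m) ℝ := h.eigenvectorUnitary
  U * diagonal (fun i => f (h.eigenvalues i)) * Uᵀ

/-- `Q^{-1/2} = U_Q Σ_Q^{-1/2} U_Qᵀ` for `Q = B Bᵀ`. -/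
noncomputable def invSqrtGram {m w : ℕ} (B : Matrix (Fin m) (Fin w) ℝ) : Matrix (Fin m) (Fin m) ℝ :=
  gramFun (fun l => (Real.sqrt l)⁻¹) B

/-- The four Penrose conditions: `P` is the Moore-Penrose pseudoinverse of `B`. -/
def IsPinv {m w : ℕ} (B : Matrix (Fin m) (Fin w) ℝ) (P : Matrix (Fin w) (Fin m) ℝ) : Prop :=
  B * P * B = B ∧ P * B * P = P ∧ (B * P)ᵀ = B * P ∧ (P * B)ᵀ = P * B

/-- The spectral norm. -/
noncomputable def specNorm {k l : ℕ} (Z : Matrix (Fin k) (Fin l) ℝ) : ℝ :=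
  ‖(Matrix.toEuclideanLin Z).toContinuousLinearMap‖

/-- The square of the Frobenius norm. -/
def frobSq {k l : ℕ} (Z : Matrix (Fin k) (Fin l) ℝ) : ℝ := ∑ i, ∑ j, Z i j ^ 2

/-! ### Sketching matrices -/

/-- `W` is an accurate sketch for `Z`:
`‖Z W Wᵀ Zᵀ - Z Zᵀ‖₂ ≤ (ζ / 4) (‖Z‖₂² + ‖Z‖_F² / r)`. -/
def SketchAccurate {k n w : ℕ} (ζ : ℝ) (r : ℕ) (Z : Matrix (Fin k) (Fin n) ℝ)
    (W : Matrix (Fin n) (Fin w) ℝ) : Prop :=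
  specNorm (Z * W * Wᵀ * Zᵀ - Z * Zᵀ) ≤ ζ / 4 * (specNorm Z ^ 2 + frobSq Z / r)

/-- A random `n × w` matrix is an oblivious sketching matrix with accuracy `ζ`, failure
probability `δ` and parameter `r`: for every fixed matrix `Z` with `n` columns it is an accurate
sketch for `Z` with probability at least `1 - δ`. -/
def IsSketchingMatrix {Ω : Type*} [MeasurableSpace Ω] (P : Measure Ω) {n w : ℕ} (ζ δ : ℝ) (r : ℕ)
    (W : Ω → Matrix (Fin n) (Fin w) ℝ) : Prop :=
  ∀ (k : ℕ) (Z : Matrix (Fin k) (Fin n) ℝ), 1 - δ ≤ P.real {ω | SketchAccurate ζ r Z (W ω)}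

/-! ### Iterative solvers for `M z = q`, started at `0` -/

/-- State of the conjugate gradient method: approximation, residual `q - M z`, direction. -/
structure CGState (m : ℕ) where
  /-- The current approximation. -/
  z : Fin m → ℝ
  /-- The current residual `q - M z`. -/
  r : Fin m → ℝ
  /-- The current search direction. -/
  d : Fin m → ℝ

/-- One step of the standard (Hestenes-Stiefel) conjugate gradient method. Once the residual is `0`,
both coefficients are `0` (division by zero) and the approximation no longer changes. -/
noncomputable def cgStep {m : ℕ} (M : Matrix (Fin m) (Fin m) ℝ) (u : CGState m) : CGState m :=
  let a : ℝ := (u.r ⬝ᵥ u.r) / (u.d ⬝ᵥ (M *ᵥ u.d))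
  let r' : Fin m → ℝ := u.r - a • (M *ᵥ u.d)
  let β : ℝ := (r' ⬝ᵥ r') / (u.r ⬝ᵥ u.r)
  { z := u.z + a • u.d, r := r', d := r' + β • u.d }

/-- The approximation after `t` steps of conjugate gradients. -/
noncomputable def cgSolve {m : ℕ} (M : Matrix (Fin m) (Fin m) ℝ) (q : Fin m → ℝ) (t : ℕ) :
    Fin m → ℝ :=
  ((cgStep M)^[t] { z := 0, r := q, d := q }).z

/-- State of Chebyshev iteration: approximation, residual `q - M z`, next correction, and the
scalar `ρ` of the recurrence. -/
structure ChebState (m : ℕ) where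
  /-- The current approximation. -/
  z : Fin m → ℝ
  /-- The current residual `q - M z`. -/
  r : Fin m → ℝ
  /-- The next correction. -/
  d : Fin m → ℝ
  /-- The scalar of the recurrence. -/
  ρ : ℝ

/-- One step of Chebyshev iteration for the spectral interval `[θ - η, θ + η]`. -/
noncomputable def chebStep {m : ℕ} (θ η : ℝ) (M : Matrix (Fin m) (Fin m) ℝ) (u : ChebState m) :
    ChebState m :=
  let r' : Fin m → ℝ := u.r - M *ᵥ u.d
  let ρ' : ℝ := (2 * (θ / η) - u.ρ)⁻¹
  { z := u.z + u.d, r := r', d := (ρ' * u.ρ) • u.d + (2 * ρ' / η) • r', ρ := ρ' }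

/-- The approximation after `t` steps of Chebyshev iteration with spectral bounds `lo < hi`. -/
noncomputable def chebSolve {m : ℕ} (lo hi : ℝ) (M : Matrix (Fin m) (Fin m) ℝ) (q : Fin m → ℝ)
    (t : ℕ) : Fin m → ℝ :=
  let θ : ℝ := (hi + lo) / 2
  let η : ℝ := (hi - lo) / 2
  ((chebStep θ η M)^[t] { z := 0, r := q, d := θ⁻¹ • q, ρ := η / θ }).z

/-- The choice of the iterative solver. -/
inductive Solver where
  | cg
  | chebyshev

/-- The output `z̃ᵗ` of the chosen solver on `M z = q`. Chebyshev iteration uses the bounds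
`(1 + ζ/2)⁻¹` and `(1 - ζ/2)⁻¹` for the spectrum. -/
noncomputable def Solver.run {m : ℕ} (sv : Solver) (ζ : ℝ) (M : Matrix (Fin m) (Fin m) ℝ)
    (q : Fin m → ℝ) (t : ℕ) : Fin m → ℝ :=
  match sv with
  | .cg => cgSolve M q t
  | .chebyshev => chebSolve (1 + ζ / 2)⁻¹ (1 - ζ / 2)⁻¹ M q t

/-! ### The long-step infeasible interior point method -/

section Method

variable {m n w : ℕ}

/-- The matrix `A D` with `D = X^{1/2} S^{-1/2}`. -/
noncomputable def scaledMatrix (L : LinProg m n) (z : Point m n) : Matrix (Fin m) (Fin n) ℝ :=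
  L.A * diagonal (fun i => Real.sqrt (z.x i / z.s i))

/-- The vector `p = -r_p - σ μ A S⁻¹ 1 + A x - A D² r_d`. -/
noncomputable def rhs (L : LinProg m n) (σ : ℝ) (z : Point m n) : Fin m → ℝ :=
  -L.primalRes z - (σ * dualityMeasure z) • (L.A *ᵥ fun i => (z.s i)⁻¹) + L.A *ᵥ z.x
    - L.A *ᵥ fun i => z.x i / z.s i * L.dualRes z i

/-- The approximate solution `Δy = Q^{-1/2} z̃ᵗ` of the normal equations `A D² Aᵀ Δy = p`, where
`Q = (A D W) (A D W)ᵀ` and `z̃ᵗ` is the output of the solver on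
`Q^{-1/2} A D² Aᵀ Q^{-1/2} z = Q^{-1/2} p` after `t` steps. -/
noncomputable def dirY (L : LinProg m n) (σ ζ : ℝ) (sv : Solver) (t : ℕ)
    (W : Matrix (Fin n) (Fin w) ℝ) (z : Point m n) : Fin m → ℝ :=
  let AD := scaledMatrix L z
  let R := invSqrtGram (AD * W)
  R *ᵥ sv.run ζ (R * (AD * ADᵀ) * R) (R *ᵥ rhs L σ z) t

/-- The correction vector `v = (X S)^{1/2} W (A D W)^† (A D² Aᵀ Δy - p)`; the argument `B` stands
for the pseudoinverse `(A D W)^†`. -/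
noncomputable def correction (L : LinProg m n) (σ : ℝ) (W : Matrix (Fin n) (Fin w) ℝ)
    (B : Matrix (Fin w) (Fin m) ℝ) (z : Point m n) (dy : Fin m → ℝ) : Fin n → ℝ :=
  let AD := scaledMatrix L z
  fun i => Real.sqrt (z.x i * z.s i) * (W *ᵥ (B *ᵥ ((AD * ADᵀ) *ᵥ dy - rhs L σ z))) i

/-- The search direction `(Δx, Δy, Δs)` built from `Δy` and the correction vector `v`:
`Δs = -r_d - Aᵀ Δy` and `Δx = -x + σ μ S⁻¹ 1 - D² Δs - S⁻¹ v`. -/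
noncomputable def direction (L : LinProg m n) (σ : ℝ) (z : Point m n) (dy : Fin m → ℝ)
    (v : Fin n → ℝ) : Point m n :=
  let ds : Fin n → ℝ := -L.dualRes z - L.Aᵀ *ᵥ dy
  let dx : Fin n → ℝ := fun i =>
    -z.x i + σ * dualityMeasure z * (z.s i)⁻¹ - z.x i / z.s i * ds i - (z.s i)⁻¹ * v i
  (dx, dy, ds)

/-- `z'` is obtained from `z` by a line search along `d`. First `α₁` is the largest step in `[0, 1]`
such that the path from `z` to `z + α₁ d` runs in the neighbourhood (a supremum, which is attained
unless the end point has duality measure `0`); then the step `α₂` minimises `x(α)ᵀ s(α)` on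
`[0, α₁]`. -/
def IsLineSearch (L : LinProg m n) (γ : ℝ) (z₀ z d z' : Point m n) : Prop :=
  ∃ α₁ α₂ : ℝ,
    IsLUB {α : ℝ | α ∈ Set.Icc (0 : ℝ) 1 ∧
      ∀ α' ∈ Set.Icc (0 : ℝ) α, z + α' • d ∈ neighborhood L γ z₀} α₁ ∧
    α₂ ∈ Set.Icc (0 : ℝ) α₁ ∧
    (∀ α ∈ Set.Icc (0 : ℝ) α₁,
      (z + α₂ • d).x ⬝ᵥ (z + α₂ • d).s ≤ (z + α • d).x ⬝ᵥ (z + α • d).s) ∧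
    z' = z + α₂ • d

/-- One pass of the loop with sketching matrix `W`: as long as the duality measure exceeds the
tolerance `τ`, the search direction is computed and the line search gives the next point `z'`;
afterwards the point is kept. -/
def IsStep (L : LinProg m n) (γ σ ζ τ : ℝ) (sv : Solver) (t : ℕ) (z₀ : Point m n)
    (W : Matrix (Fin n) (Fin w) ℝ) (z z' : Point m n) : Prop :=
  (τ < dualityMeasure z →
    ∃ B : Matrix (Fin w) (Fin m) ℝ, IsPinv (scaledMatrix L z * W) B ∧
      let dy := dirY L σ ζ sv t W z
      let v := correction L σ W B z dy
      IsLineSearch L γ z₀ z (direction L σ z dy v) z') ∧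
  (dualityMeasure z ≤ τ → z' = z)

/-- The random sequence `z` is produced by the long-step infeasible interior point method started
at `z₀`, with tolerance `τ`. In pass `k` the sketching matrix `W k` has accuracy `ζ` and failure
probability `δ` and is independent of the current iterate. -/
structure IsInfeasibleIPM {Ω : Type*} [MeasurableSpace Ω] (P : Measure Ω) (L : LinProg m n)
    (γ σ ζ δ τ : ℝ) (sv : Solver) (t : ℕ) (z₀ : Point m n)
    (W : ℕ → Ω → Fin n → Fin w → ℝ) (z : ℕ → Ω → Point m n) : Prop where
  measurable_sketch : ∀ k, Measurable (W k)
  measurable_iterate : ∀ k, Measurable (z k)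
  sketch : ∀ k, IsSketchingMatrix P ζ δ m (fun ω => Matrix.of (W k ω))
  indep : ∀ k, IndepFun (W k) (z k) P
  init : ∀ ω, z 0 ω = z₀
  step : ∀ k ω, IsStep L γ σ ζ τ sv t z₀ (Matrix.of (W k ω)) (z k ω) (z (k + 1) ω)

end Method

/-! The correction `v` is built so that inexact solves do no harm to feasibility. A good sketch
gives `A D W` full row rank, so `(A D W)(A D W)^† = 1` and `A S⁻¹ v` is exactly the error left in
the normal equations. The direction therefore cancels both residuals, and along the run `r = η r⁰`
with `η μ₀ ≤ μ`. Only the complementarity equation is perturbed, by `-v`.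

The size of `v` is controlled by three facts: the preconditioned matrix has spectrum in `[4/5,
4/3]`, so both solvers contract the residual geometrically; the sketch satisfies `‖W‖² ≤ 2n`; and `p
= A D g` with `‖g‖ = O(n √(Λμ))` (`exists_rhs_preimage`). Hence `O(log n)` solver steps push `‖v‖`
below `μ / (16 Λ²)` (`correction_bound`).

For the direction itself, strong duality makes `x*` and `s*` complementary, and `Δx + η(x⁰ - x*)` is
orthogonal to `Δs + η(s⁰ - s*)`. With the bound `η (sᵀx⁰ + xᵀs⁰) ≤ 3 xᵀs` of
`GoodStart.infeasibility_bound`, Pythagoras bounds the scaled direction by `O(n √(Λμ))`, so the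
second-order terms are `O(n² Λ μ)`. A step of length `1 / (2000 Λ³ n²)` then stays in the
neighbourhood and shrinks `μ` by a fixed fraction of its length (`Central.short_step`); the line
search does no worse. This gives `O(n² log(1/ε))` passes, and the neighbourhood carries the decrease
of `μ` over to the residual.

A pass needs the sketch guarantee for just two matrices: `A D` with orthonormalised rows, and the
identity. Independence allows the iterate to be frozen, so a pass fails with probability at most
`2δ`, and a union bound over the passes finishes. -/

/-! ### The Euclidean norm of a coordinate vector -/

/-- The Euclidean norm of a vector. -/
noncomputable def l2 {k : ℕ} (u : Fin k → ℝ) : ℝ := ‖WithLp.toLp 2 u‖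

section EuclideanNorm

variable {k l : ℕ}

theorem l2_nonneg (u : Fin k → ℝ) : 0 ≤ l2 u := norm_nonneg _

theorem l2_sq (u : Fin k → ℝ) : l2 u ^ 2 = u ⬝ᵥ u := by
  simp only [l2, EuclideanSpace.norm_sq_eq, dotProduct, Real.norm_eq_abs, sq_abs]
  exact Finset.sum_congr rfl fun i _ => sq (u i)

theorem l2_add_le (u v : Fin k → ℝ) : l2 (u + v) ≤ l2 u + l2 v := norm_add_le _ _

theorem l2_sub_le (u v : Fin k → ℝ) : l2 (u - v) ≤ l2 u + l2 v := norm_sub_le _ _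

theorem l2_neg (u : Fin k → ℝ) : l2 (-u) = l2 u := norm_neg _

theorem l2_smul (a : ℝ) (u : Fin k → ℝ) : l2 (a • u) = |a| * l2 u := norm_smul a _

theorem l2_zero : l2 (0 : Fin k → ℝ) = 0 := norm_zero

theorem abs_dotProduct_le_l2 (u v : Fin k → ℝ) : |u ⬝ᵥ v| ≤ l2 u * l2 v := by
  have h := abs_real_inner_le_norm (WithLp.toLp 2 v) (WithLp.toLp 2 u)
  rw [EuclideanSpace.inner_eq_star_dotProduct] at h
  simpa [l2, mul_comm] using h

theorem dotProduct_le_l2 (u v : Fin k → ℝ) : u ⬝ᵥ v ≤ l2 u * l2 v :=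
  (le_abs_self _).trans (abs_dotProduct_le_l2 u v)

theorem abs_apply_le_l2 (u : Fin k → ℝ) (i : Fin k) : |u i| ≤ l2 u := by
  simpa [l2] using PiLp.norm_apply_le (WithLp.toLp 2 u) i

theorem dotProduct_self_nonneg' (u : Fin k → ℝ) : 0 ≤ u ⬝ᵥ u := by
  rw [← l2_sq]; positivity

theorem dotProduct_self_pos {u : Fin k → ℝ} (hu : u ≠ 0) : 0 < u ⬝ᵥ u :=
  lt_of_le_of_ne (dotProduct_self_nonneg' u) fun h => hu (dotProduct_self_eq_zero.mp h.symm)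

theorem l2_le_of_sq_le {u : Fin k → ℝ} {c : ℝ} (hc : 0 ≤ c) (h : u ⬝ᵥ u ≤ c ^ 2) : l2 u ≤ c :=
  abs_le_of_sq_le_sq' (by rwa [l2_sq]) hc |>.2

theorem l2_le_sum_abs (u : Fin k → ℝ) : l2 u ≤ ∑ i, |u i| := by
  refine l2_le_of_sq_le (Finset.sum_nonneg fun i _ => abs_nonneg _) ?_
  have : u ⬝ᵥ u = ∑ i, |u i| ^ 2 := by
    simp only [dotProduct, sq_abs]
    exact Finset.sum_congr rfl fun i _ => (sq (u i)).symm
  rw [this]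
  exact Finset.sum_sq_le_sq_sum_of_nonneg fun i _ => abs_nonneg _

theorem dotProduct_mulVec_comm (M : Matrix (Fin k) (Fin l) ℝ) (u : Fin k → ℝ) (v : Fin l → ℝ) :
    u ⬝ᵥ (M *ᵥ v) = (Mᵀ *ᵥ u) ⬝ᵥ v := by
  rw [dotProduct_mulVec, ← mulVec_transpose]

/-- A matrix and its transpose satisfy the same operator norm bounds. -/
theorem l2_mulVec_le_of_transpose {M : Matrix (Fin k) (Fin l) ℝ} {c : ℝ} (hc : 0 ≤ c)
    (h : ∀ u, l2 (Mᵀ *ᵥ u) ≤ c * l2 u) (v : Fin l → ℝ) : l2 (M *ᵥ v) ≤ c * l2 v := by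
  have h1 : l2 (M *ᵥ v) ^ 2 ≤ c * l2 (M *ᵥ v) * l2 v := by
    rw [l2_sq, dotProduct_mulVec_comm]
    exact (dotProduct_le_l2 _ _).trans (mul_le_mul_of_nonneg_right (h _) (l2_nonneg _))
  rcases (l2_nonneg (M *ᵥ v)).eq_or_lt with h0 | h0
  · rw [← h0]
    exact mul_nonneg hc (l2_nonneg v)
  · nlinarith

/-- A symmetric matrix whose quadratic form is bounded by `‖u‖²` is a contraction. -/
theorem l2_mulVec_le_of_quadratic {N : Matrix (Fin k) (Fin k) ℝ} (hN : Nᵀ = N)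
    (h : ∀ u, |u ⬝ᵥ (N *ᵥ u)| ≤ u ⬝ᵥ u) (u : Fin k → ℝ) : l2 (N *ᵥ u) ≤ l2 u := by
  refine l2_le_of_sq_le (l2_nonneg u) ?_
  rw [l2_sq]
  set v := N *ᵥ u with hv
  -- Polarisation: the forms at `u + v` and `u - v` differ by `4 v ⬝ᵥ v`, and the parallelogram law
  -- bounds this by `2 u ⬝ᵥ u + 2 v ⬝ᵥ v`.
  have h1 := (abs_le.mp (h (u + v))).2
  have h2 := (abs_le.mp (h (u - v))).1
  have h3 : u ⬝ᵥ (N *ᵥ v) = v ⬝ᵥ v := by rw [dotProduct_mulVec_comm, hN]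
  have h4 : v ⬝ᵥ u = u ⬝ᵥ v := dotProduct_comm _ _
  simp only [mulVec_add, mulVec_sub, add_dotProduct, sub_dotProduct, dotProduct_add,
    dotProduct_sub, h3, h4, ← hv] at h1 h2
  linarith

end EuclideanNorm

/-! ### Convergence of the solvers -/

section Solvers

variable {m : ℕ} {M : Matrix (Fin m) (Fin m) ℝ} {q : Fin m → ℝ}

theorem quadratic_cauchy_schwarz (hM : Mᵀ = M) (hpos : ∀ u, 0 ≤ u ⬝ᵥ (M *ᵥ u))
    (u v : Fin m → ℝ) : (u ⬝ᵥ (M *ᵥ v)) ^ 2 ≤ (u ⬝ᵥ (M *ᵥ u)) * (v ⬝ᵥ (M *ᵥ v)) := by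
  have hsymm : v ⬝ᵥ (M *ᵥ u) = u ⬝ᵥ (M *ᵥ v) := by
    rw [dotProduct_mulVec_comm, hM, dotProduct_comm]
  have key : ∀ x : ℝ, 0 ≤ (v ⬝ᵥ (M *ᵥ v)) * (x * x) + (2 * (u ⬝ᵥ (M *ᵥ v))) * x
      + u ⬝ᵥ (M *ᵥ u) := by
    intro x
    have := hpos (u + x • v)
    simp only [mulVec_add, mulVec_smul, add_dotProduct, dotProduct_add, smul_dotProduct,
      dotProduct_smul, smul_eq_mul, hsymm] at this
    linarith
  have := discrim_le_zero key
  rw [discrim] at this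
  nlinarith

/-- The invariant of conjugate gradients which drives convergence; `x` is the exact solution. -/
structure CGInvariant (M : Matrix (Fin m) (Fin m) ℝ) (x : Fin m → ℝ) (u : CGState m) : Prop where
  res : u.r = M *ᵥ (x - u.z)
  orth : u.r ⬝ᵥ u.d = u.r ⬝ᵥ u.r
  conj : u.r ⬝ᵥ (M *ᵥ u.d) = u.d ⬝ᵥ (M *ᵥ u.d)

theorem CGInvariant.direction_ne_zero {x : Fin m → ℝ} {u : CGState m} (h : CGInvariant M x u)
    (hr : u.r ≠ 0) : u.d ≠ 0 := by
  intro hd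
  have := h.orth
  rw [hd, dotProduct_zero] at this
  exact hr (dotProduct_self_eq_zero.mp this.symm)

/-- Relations between the current residual and direction alone propagate; the conjugacy of all
earlier directions is not needed. `conj` records that `d - r`, a multiple of the previous direction,
is `M`-orthogonal to `d`. -/
theorem CGInvariant.step {x : Fin m → ℝ} {u : CGState m} (hM : Mᵀ = M)
    (hpos : ∀ u, u ≠ 0 → 0 < u ⬝ᵥ (M *ᵥ u)) (h : CGInvariant M x u) :
    CGInvariant M x (cgStep M u) := by
  by_cases hr : u.r = 0
  · have : cgStep M u = { z := u.z, r := 0, d := 0 } := by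
      simp [cgStep, hr]
    rw [this]
    exact ⟨by rw [← h.res, hr], by simp, by simp⟩
  have hd := hpos _ (h.direction_ne_zero hr)
  have hrr := dotProduct_self_pos hr
  set a : ℝ := (u.r ⬝ᵥ u.r) / (u.d ⬝ᵥ (M *ᵥ u.d)) with ha
  set r' : Fin m → ℝ := u.r - a • (M *ᵥ u.d) with hr'
  set β : ℝ := (r' ⬝ᵥ r') / (u.r ⬝ᵥ u.r) with hβ
  have hstep : cgStep M u = { z := u.z + a • u.d, r := r', d := r' + β • u.d } := rfl
  have ha' : a * (u.d ⬝ᵥ (M *ᵥ u.d)) = u.r ⬝ᵥ u.r := div_mul_cancel₀ _ hd.ne'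
  have hβ' : β * (u.r ⬝ᵥ u.r) = r' ⬝ᵥ r' := div_mul_cancel₀ _ hrr.ne'
  have ha0 : a ≠ 0 := (div_pos hrr hd).ne'
  have h1 : r' ⬝ᵥ u.d = 0 := by
    rw [hr', sub_dotProduct, smul_dotProduct, h.orth, dotProduct_comm (M *ᵥ u.d), smul_eq_mul, ha',
      sub_self]
  have h2 : r' ⬝ᵥ u.r = 0 := by
    rw [hr', sub_dotProduct, smul_dotProduct, dotProduct_comm (M *ᵥ u.d), h.conj, smul_eq_mul, ha',
      sub_self]
  have h3 : a * (r' ⬝ᵥ (M *ᵥ u.d)) = -(r' ⬝ᵥ r') := by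
    have : r' ⬝ᵥ r' = r' ⬝ᵥ u.r - a * (r' ⬝ᵥ (M *ᵥ u.d)) := by
      nth_rewrite 2 [hr']
      rw [dotProduct_sub, dotProduct_smul, smul_eq_mul]
    rw [this, h2]
    ring
  have h4 : (r' + β • u.d) ⬝ᵥ (M *ᵥ u.d) = 0 := by
    refine (mul_eq_zero.mp ?_).resolve_left ha0
    rw [add_dotProduct, smul_dotProduct, smul_eq_mul, mul_add, h3]
    linear_combination β * ha' + hβ'
  rw [hstep]
  refine ⟨?_, ?_, ?_⟩
  · simp only [hr', h.res, mulVec_sub, mulVec_add, mulVec_smul]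
    abel
  · simp only [dotProduct_add, dotProduct_smul, h1, smul_zero, add_zero]
  · have h5 : u.d ⬝ᵥ (M *ᵥ (r' + β • u.d)) = 0 := by
      rw [dotProduct_mulVec_comm, hM, dotProduct_comm, h4]
    simp only [add_dotProduct, smul_dotProduct] at h5 ⊢
    rw [h5, smul_zero, add_zero]

/-- Comparison with steepest descent. The exact step `a` lowers the energy by `a (r ⬝ᵥ r)`.
Cauchy-Schwarz and `conj` give `d ⬝ᵥ M d ≤ r ⬝ᵥ M r`, hence `a ≥ 1 / hi`, while `r ⬝ᵥ r` is at least
`lo` times the energy. This rate is weaker than the optimal one but suffices here. -/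
theorem CGInvariant.energy_step {x : Fin m → ℝ} {u : CGState m} {lo hi : ℝ} (hM : Mᵀ = M)
    (hlo : 0 < lo) (h1 : ∀ u, lo * (u ⬝ᵥ u) ≤ u ⬝ᵥ (M *ᵥ u))
    (h2 : ∀ u, u ⬝ᵥ (M *ᵥ u) ≤ hi * (u ⬝ᵥ u)) (h : CGInvariant M x u) :
    (x - (cgStep M u).z) ⬝ᵥ (M *ᵥ (x - (cgStep M u).z)) ≤
      (1 - lo / hi) * ((x - u.z) ⬝ᵥ (M *ᵥ (x - u.z))) := by
  have hpos : ∀ u, u ≠ 0 → 0 < u ⬝ᵥ (M *ᵥ u) := fun u hu =>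
    (mul_pos hlo (dotProduct_self_pos hu)).trans_le (h1 u)
  have hnn : ∀ u, 0 ≤ u ⬝ᵥ (M *ᵥ u) := fun u =>
    (mul_nonneg hlo.le (dotProduct_self_nonneg' u)).trans (h1 u)
  set e := x - u.z with he
  by_cases hr : u.r = 0
  · have hz : e = 0 := by
      by_contra hne
      have := hpos e hne
      rw [← h.res, hr, dotProduct_zero] at this
      exact this.false
    have : (cgStep M u).z = u.z := by simp [cgStep, hr]
    rw [this, ← he, hz]
    simp
  have hd := hpos _ (h.direction_ne_zero hr)
  have hrr := dotProduct_self_pos hr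
  have hhi : 0 < hi := by
    have := (hpos _ hr).trans_le (h2 u.r)
    exact pos_of_mul_pos_left this hrr.le
  set a : ℝ := (u.r ⬝ᵥ u.r) / (u.d ⬝ᵥ (M *ᵥ u.d)) with ha
  have hz : x - (cgStep M u).z = e - a • u.d := by
    change x - (u.z + a • u.d) = _
    rw [he]
    abel
  have ha' : a * (u.d ⬝ᵥ (M *ᵥ u.d)) = u.r ⬝ᵥ u.r := div_mul_cancel₀ _ hd.ne'
  have hed : e ⬝ᵥ (M *ᵥ u.d) = u.r ⬝ᵥ u.r := by
    rw [dotProduct_mulVec_comm, hM, ← h.res, h.orth]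
  have hde : u.d ⬝ᵥ (M *ᵥ e) = u.r ⬝ᵥ u.r := by
    rw [← h.res, dotProduct_comm, h.orth]
  have hE : (e - a • u.d) ⬝ᵥ (M *ᵥ (e - a • u.d)) = e ⬝ᵥ (M *ᵥ e) - a * (u.r ⬝ᵥ u.r) := by
    simp only [mulVec_sub, mulVec_smul, sub_dotProduct, dotProduct_sub, smul_dotProduct,
      dotProduct_smul, smul_eq_mul, hed, hde]
    linear_combination a * ha'
  rw [hz, hE]
  have hdr : u.d ⬝ᵥ (M *ᵥ u.d) ≤ u.r ⬝ᵥ (M *ᵥ u.r) := by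
    have := quadratic_cauchy_schwarz hM hnn u.r u.d
    rw [h.conj, sq] at this
    exact le_of_mul_le_mul_right this hd
  have ha_ge : 1 / hi ≤ a := by
    rw [div_le_iff₀ hhi, ha, div_mul_eq_mul_div, le_div_iff₀ hd]
    linarith [h2 u.r]
  have hEle : lo * (e ⬝ᵥ (M *ᵥ e)) ≤ u.r ⬝ᵥ u.r := by
    have hcs : (e ⬝ᵥ (M *ᵥ e)) ^ 2 ≤ (e ⬝ᵥ e) * (u.r ⬝ᵥ u.r) := by
      rw [← h.res, ← sq_abs, ← l2_sq, ← l2_sq, ← mul_pow]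
      exact pow_le_pow_left₀ (abs_nonneg _) (abs_dotProduct_le_l2 _ _) 2
    rcases (hnn e).eq_or_lt with h0 | h0
    · rw [← h0, mul_zero]; exact hrr.le
    · have h3 := mul_le_mul_of_nonneg_right (h1 e) hrr.le
      have h4 : lo * (e ⬝ᵥ (M *ᵥ e)) * (e ⬝ᵥ (M *ᵥ e)) ≤ (u.r ⬝ᵥ u.r) * (e ⬝ᵥ (M *ᵥ e)) := by
        nlinarith
      exact le_of_mul_le_mul_right h4 h0
  have h5 : 1 / hi * (lo * (e ⬝ᵥ (M *ᵥ e))) ≤ a * (u.r ⬝ᵥ u.r) :=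
    mul_le_mul ha_ge hEle (mul_nonneg hlo.le (hnn e)) ((by positivity : 0 ≤ 1 / hi).trans ha_ge)
  calc _ ≤ e ⬝ᵥ (M *ᵥ e) - 1 / hi * (lo * (e ⬝ᵥ (M *ᵥ e))) := by linarith
    _ = _ := by ring

theorem cg_energy_le {x : Fin m → ℝ} {lo hi : ℝ} (hM : Mᵀ = M)
    (hlo : 0 < lo) (hlh : lo ≤ hi) (h1 : ∀ u, lo * (u ⬝ᵥ u) ≤ u ⬝ᵥ (M *ᵥ u))
    (h2 : ∀ u, u ⬝ᵥ (M *ᵥ u) ≤ hi * (u ⬝ᵥ u)) (t : ℕ) :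
    (x - cgSolve M (M *ᵥ x) t) ⬝ᵥ (M *ᵥ (x - cgSolve M (M *ᵥ x) t)) ≤
      (1 - lo / hi) ^ t * (x ⬝ᵥ (M *ᵥ x)) := by
  have hpos : ∀ u, u ≠ 0 → 0 < u ⬝ᵥ (M *ᵥ u) := fun u hu =>
    (mul_pos hlo (dotProduct_self_pos hu)).trans_le (h1 u)
  set u₀ : CGState m := { z := 0, r := M *ᵥ x, d := M *ᵥ x }
  have hrate : 0 ≤ 1 - lo / hi := sub_nonneg.mpr ((div_le_one (hlo.trans_le hlh)).mpr hlh)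
  have key : CGInvariant M x ((cgStep M)^[t] u₀) ∧
      (x - ((cgStep M)^[t] u₀).z) ⬝ᵥ (M *ᵥ (x - ((cgStep M)^[t] u₀).z)) ≤
      (1 - lo / hi) ^ t * (x ⬝ᵥ (M *ᵥ x)) := by
    induction t with
    | zero => exact ⟨⟨by simp [u₀], by simp [u₀], by simp [u₀]⟩, by simp [u₀]⟩
    | succ t ih =>
      rw [Function.iterate_succ_apply']
      refine ⟨ih.1.step hM hpos, (ih.1.energy_step hM hlo h1 h2).trans ?_⟩
      rw [pow_succ', mul_assoc]
      exact mul_le_mul_of_nonneg_left ih.2 hrate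
  exact key.2

/-- The residual of conjugate gradients for a matrix with spectrum in `[4/5, 4/3]`. -/
theorem cgSolve_residual_le (hM : Mᵀ = M) (h1 : ∀ u, 4 / 5 * (u ⬝ᵥ u) ≤ u ⬝ᵥ (M *ᵥ u))
    (h2 : ∀ u, u ⬝ᵥ (M *ᵥ u) ≤ 4 / 3 * (u ⬝ᵥ u)) (q : Fin m → ℝ) (t : ℕ) :
    l2 (q - M *ᵥ cgSolve M q t) ≤ 2 * (2 / 3) ^ t * l2 q := by
  have hinj : Function.Injective M.mulVecLin := by
    rw [← LinearMap.ker_eq_bot, LinearMap.ker_eq_bot']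
    intro u hu
    rw [mulVecLin_apply] at hu
    have := h1 u
    rw [hu, dotProduct_zero] at this
    by_contra hne
    linarith [dotProduct_self_pos hne]
  obtain ⟨x, rfl⟩ := LinearMap.surjective_of_injective hinj q
  rw [mulVecLin_apply]
  have hnn : ∀ u, 0 ≤ u ⬝ᵥ (M *ᵥ u) := fun u =>
    (mul_nonneg (by norm_num) (dotProduct_self_nonneg' u)).trans (h1 u)
  have hE := cg_energy_le (x := x) hM (by norm_num) (by norm_num) h1 h2 t
  set e := x - cgSolve M (M *ᵥ x) t with he
  have hres : M *ᵥ x - M *ᵥ cgSolve M (M *ᵥ x) t = M *ᵥ e := by rw [he, mulVec_sub]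
  rw [hres]
  -- bounds between the energy and the residual norm
  have hup : ∀ u, l2 (M *ᵥ u) ^ 2 ≤ 4 / 3 * (u ⬝ᵥ (M *ᵥ u)) := fun u => by
    have h3 := quadratic_cauchy_schwarz hM hnn (M *ᵥ u) u
    have h4 := h2 (M *ᵥ u)
    rw [l2_sq]
    rcases (dotProduct_self_nonneg' (M *ᵥ u)).eq_or_lt with h0 | h0
    · rw [← h0]; linarith [hnn u]
    · have h5 := mul_le_mul_of_nonneg_right h4 (hnn u)
      have : ((M *ᵥ u) ⬝ᵥ (M *ᵥ u)) * ((M *ᵥ u) ⬝ᵥ (M *ᵥ u)) ≤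
          (4 / 3 * (u ⬝ᵥ (M *ᵥ u))) * ((M *ᵥ u) ⬝ᵥ (M *ᵥ u)) := by nlinarith
      exact le_of_mul_le_mul_right this h0
  have hdown : x ⬝ᵥ (M *ᵥ x) ≤ 5 / 4 * l2 (M *ᵥ x) ^ 2 := by
    have h3 : 4 / 5 * l2 x ^ 2 ≤ l2 x * l2 (M *ᵥ x) := by
      rw [l2_sq]
      exact (h1 x).trans (dotProduct_le_l2 _ _)
    have h4 := dotProduct_le_l2 x (M *ᵥ x)
    nlinarith [sq_nonneg (4 / 5 * l2 x - l2 (M *ᵥ x)), sq_nonneg (l2 (M *ᵥ x)),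
      l2_nonneg x, l2_nonneg (M *ᵥ x)]
  refine abs_le_of_sq_le_sq' ?_ (mul_nonneg (by positivity) (l2_nonneg _)) |>.2
  -- The energy rate is `2/5 ≤ (2/3)²`. The conversions between energy and residual cost `4/3 · 5/4
  -- = 5/3 ≤ 2²`.
  have hpow : (1 - 4 / 5 / (4 / 3) : ℝ) ^ t ≤ ((2 / 3) ^ t) ^ 2 := by
    rw [← pow_mul, mul_comm t 2, pow_mul]
    exact pow_le_pow_left₀ (by norm_num) (by norm_num) t
  have hx0 := hnn x
  calc l2 (M *ᵥ e) ^ 2 ≤ 4 / 3 * ((1 - 4 / 5 / (4 / 3)) ^ t * (x ⬝ᵥ (M *ᵥ x))) :=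
        (hup e).trans (by linarith)
    _ ≤ 4 / 3 * (((2 / 3) ^ t) ^ 2 * (5 / 4 * l2 (M *ᵥ x) ^ 2)) := by gcongr
    _ ≤ _ := by
        have : 0 ≤ ((2 / 3 : ℝ) ^ t) ^ 2 * l2 (M *ᵥ x) ^ 2 := by positivity
        nlinarith

/-- The residual of Chebyshev iteration for a matrix with spectrum in `[4/5, 4/3]`. -/
theorem chebSolve_residual_le (hM : Mᵀ = M) (h1 : ∀ u, 4 / 5 * (u ⬝ᵥ u) ≤ u ⬝ᵥ (M *ᵥ u))
    (h2 : ∀ u, u ⬝ᵥ (M *ᵥ u) ≤ 4 / 3 * (u ⬝ᵥ u)) (q : Fin m → ℝ) (t : ℕ) :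
    l2 (q - M *ᵥ chebSolve (4 / 5) (4 / 3) M q t) ≤ (1 / 2) ^ t * l2 q := by
  -- The matrix is `(θ - M) / η` with `θ = 16/15`, `η = 4/15`; it maps the spectral interval onto
  -- `[-1, 1]`.
  have hNM : ∀ u, l2 ((4 : ℝ) • u - (15 / 4 : ℝ) • (M *ᵥ u)) ≤ l2 u := by
    intro u
    have h := l2_mulVec_le_of_quadratic (N := (4 : ℝ) • (1 : Matrix (Fin m) (Fin m) ℝ)
      - (15 / 4 : ℝ) • M) (by rw [transpose_sub, transpose_smul, transpose_smul, hM, transpose_one])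
      (fun u => by
        have h3 := h1 u
        have h4 := h2 u
        simp only [sub_mulVec, smul_mulVec, one_mulVec, dotProduct_sub, dotProduct_smul,
          smul_eq_mul]
        rw [abs_le]
        constructor <;> linarith) u
    simpa only [sub_mulVec, smul_mulVec, one_mulVec] using h
  have hθ : ((4 / 3 + 4 / 5) / 2 : ℝ) = 16 / 15 := by norm_num
  have hη : ((4 / 3 - 4 / 5) / 2 : ℝ) = 4 / 15 := by norm_num
  unfold chebSolve
  simp only [hθ, hη]
  set u₀ : ChebState m :=
    { z := 0, r := q, d := (16 / 15 : ℝ)⁻¹ • q, ρ := 4 / 15 / (16 / 15) } with hu₀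
  set f := chebStep (16 / 15) (4 / 15) M
  -- The residuals obey a three-term recurrence, so two consecutive ones are tracked. From `ρ ≤ 1/4`
  -- follows `ρ' ≤ 4/31`, and the induction closes because `8/31 · 1/2 + 1/31 ≤ 1/4`.
  have key : (f^[t] u₀).r = q - M *ᵥ (f^[t] u₀).z ∧ 0 < (f^[t] u₀).ρ ∧ (f^[t] u₀).ρ ≤ 1 / 4 ∧
      l2 (f^[t] u₀).r ≤ (1 / 2) ^ t * l2 q ∧
      l2 ((f^[t] u₀).r - M *ᵥ (f^[t] u₀).d) ≤ (1 / 2) ^ (t + 1) * l2 q := by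
    induction t with
    | zero =>
      refine ⟨by simp [hu₀], by norm_num [hu₀], by norm_num [hu₀], by simp [hu₀], ?_⟩
      have : q - M *ᵥ ((16 / 15 : ℝ)⁻¹ • q) = (1 / 4 : ℝ) • ((4 : ℝ) • q - (15 / 4 : ℝ) • (M *ᵥ q)) := by
        rw [mulVec_smul]
        module
      change l2 (q - M *ᵥ ((16 / 15 : ℝ)⁻¹ • q)) ≤ _
      rw [this, l2_smul, abs_of_pos (by norm_num)]
      linarith [hNM q, l2_nonneg q]
    | succ t ih =>
      rw [Function.iterate_succ_apply']
      obtain ⟨hr, hρ0, hρ, hl, hl'⟩ := ih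
      generalize f^[t] u₀ = u at *
      set ρ' : ℝ := (2 * ((16 / 15) / (4 / 15)) - u.ρ)⁻¹ with hρ'
      set r' := u.r - M *ᵥ u.d with hr'
      have hf : f u = ⟨u.z + u.d, r', (ρ' * u.ρ) • u.d + (2 * ρ' / (4 / 15)) • r', ρ'⟩ := rfl
      have hρ'0 : 0 < ρ' := inv_pos.mpr (by linarith)
      have hρ'1 : ρ' ≤ 4 / 31 := by
        rw [hρ', inv_le_comm₀ (by linarith) (by norm_num)]
        linarith
      -- This identity collects the coefficient of `r'`, turning the recurrence into `2ρ' N r' - ρ'ρ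
      -- r` with the contraction `N` of `hNM`.
      have hρρ : 1 + ρ' * u.ρ = 8 * ρ' := by
        have : ρ' * (2 * ((16 / 15) / (4 / 15)) - u.ρ) = 1 := inv_mul_cancel₀ (by linarith)
        linarith
      rw [hf]
      refine ⟨?_, hρ'0, by linarith, hl', ?_⟩
      · simp only [hr', hr, mulVec_add]
        abel
      · have h3 : r' - M *ᵥ ((ρ' * u.ρ) • u.d + (2 * ρ' / (4 / 15)) • r')
            = (2 * ρ') • ((4 : ℝ) • r' - (15 / 4 : ℝ) • (M *ᵥ r')) - (ρ' * u.ρ) • u.r := by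
          have h4 : M *ᵥ u.d = u.r - r' := by rw [hr']; abel
          rw [mulVec_add, mulVec_smul, mulVec_smul, h4]
          have h5 : r' = (8 * ρ' - ρ' * u.ρ) • r' := by
            rw [← hρρ]; simp
          nth_rewrite 1 [h5]
          module
        dsimp only
        rw [h3]
        refine (l2_sub_le _ _).trans ?_
        rw [l2_smul, l2_smul, abs_of_pos (by positivity), abs_of_pos (by positivity)]
        have h6 : 2 * ρ' * l2 ((4 : ℝ) • r' - (15 / 4 : ℝ) • (M *ᵥ r'))
            ≤ 8 / 31 * ((1 / 2) ^ (t + 1) * l2 q) :=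
          mul_le_mul (by linarith) ((hNM r').trans hl') (l2_nonneg _) (by norm_num)
        have h7 : ρ' * u.ρ * l2 u.r ≤ 1 / 31 * ((1 / 2) ^ t * l2 q) := by
          refine mul_le_mul ?_ hl (l2_nonneg _) (by norm_num)
          nlinarith
        have h8 : 0 ≤ (1 / 2 : ℝ) ^ t * l2 q := mul_nonneg (by positivity) (l2_nonneg q)
        rw [pow_succ] at h6 ⊢
        rw [pow_succ]
        linarith
  rw [← key.1]
  exact key.2.2.2.1

theorem Solver.residual_le (sv : Solver) (hM : Mᵀ = M)
    (h1 : ∀ u, 4 / 5 * (u ⬝ᵥ u) ≤ u ⬝ᵥ (M *ᵥ u))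
    (h2 : ∀ u, u ⬝ᵥ (M *ᵥ u) ≤ 4 / 3 * (u ⬝ᵥ u)) (q : Fin m → ℝ) (t : ℕ) :
    l2 (q - M *ᵥ sv.run (1 / 2) M q t) ≤ 2 * (2 / 3) ^ t * l2 q := by
  cases sv with
  | cg => exact cgSolve_residual_le hM h1 h2 q t
  | chebyshev =>
    have hlo : ((1 + 1 / 2 / 2 : ℝ))⁻¹ = 4 / 5 := by norm_num
    have hhi : ((1 - 1 / 2 / 2 : ℝ))⁻¹ = 4 / 3 := by norm_num
    simp only [Solver.run, hlo, hhi]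
    refine (chebSolve_residual_le hM h1 h2 q t).trans ?_
    refine mul_le_mul_of_nonneg_right ?_ (l2_nonneg q)
    have : (1 / 2 : ℝ) ^ t ≤ (2 / 3) ^ t := pow_le_pow_left₀ (by norm_num) (by norm_num) t
    have : 0 ≤ (2 / 3 : ℝ) ^ t := by positivity
    linarith

end Solvers

/-! ### The inverse square root of a Gram matrix -/

section Gram

variable {m n w : ℕ}

theorem gramFun_transpose (f : ℝ → ℝ) (B : Matrix (Fin m) (Fin w) ℝ) :
    (gramFun f B)ᵀ = gramFun f B := by
  simp only [gramFun, transpose_mul, transpose_transpose, diagonal_transpose, Matrix.mul_assoc]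

theorem invSqrtGram_transpose (B : Matrix (Fin m) (Fin w) ℝ) :
    (invSqrtGram B)ᵀ = invSqrtGram B := gramFun_transpose _ B

theorem invSqrtGram_mul_mul {B : Matrix (Fin m) (Fin w) ℝ} (hB : ∀ y, Bᵀ *ᵥ y = 0 → y = 0) :
    invSqrtGram B * (B * Bᵀ) * invSqrtGram B = 1 := by
  have h : (B * Bᴴ).IsHermitian := isHermitian_mul_conjTranspose_self B
  have hpos : (B * Bᴴ).PosDef := by
    refine PosDef.of_dotProduct_mulVec_pos h fun x hx => ?_
    rw [star_trivial, ← mulVec_mulVec, dotProduct_mulVec_comm, conjTranspose_eq_transpose_of_trivial]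
    exact dotProduct_self_pos fun h0 => hx (hB x h0)
  have hev : ∀ i, 0 < h.eigenvalues i := hpos.eigenvalues_pos
  set U : Matrix (Fin m) (Fin m) ℝ := ↑h.eigenvectorUnitary with hU
  have hUU : Uᵀ * U = 1 := by
    have := Unitary.coe_star_mul_self h.eigenvectorUnitary
    rwa [star_eq_conjTranspose, conjTranspose_eq_transpose_of_trivial] at this
  have hUU' : U * Uᵀ = 1 := mul_eq_one_comm.mp hUU
  have hspec : B * Bᵀ = U * diagonal h.eigenvalues * Uᵀ := by
    have := h.spectral_theorem
    rw [Unitary.conjStarAlgAut_apply, star_eq_conjTranspose, ← hU,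
      conjTranspose_eq_transpose_of_trivial U] at this
    calc B * Bᵀ = B * Bᴴ := by rw [conjTranspose_eq_transpose_of_trivial]
      _ = _ := this
  have hR : invSqrtGram B = U * diagonal (fun i => (Real.sqrt (h.eigenvalues i))⁻¹) * Uᵀ := rfl
  rw [hR, hspec]
  set E := diagonal (fun i => (Real.sqrt (h.eigenvalues i))⁻¹)
  have hE : E * diagonal h.eigenvalues * E = 1 := by
    simp only [E, diagonal_mul_diagonal]
    rw [← diagonal_one]
    congr 1
    ext i
    have h1 := Real.sqrt_ne_zero'.mpr (hev i)
    have h2 := Real.mul_self_sqrt (hev i).le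
    field_simp
    rw [sq, h2]
  calc U * E * Uᵀ * (U * diagonal h.eigenvalues * Uᵀ) * (U * E * Uᵀ)
      = U * E * (Uᵀ * U) * diagonal h.eigenvalues * (Uᵀ * U) * E * Uᵀ := by
        simp only [Matrix.mul_assoc]
    _ = U * (E * diagonal h.eigenvalues * E) * Uᵀ := by
        simp only [hUU, Matrix.mul_one, Matrix.mul_assoc]
    _ = 1 := by rw [hE, Matrix.mul_one, hUU']

theorem l2_transpose_mulVec_sq (B : Matrix (Fin m) (Fin w) ℝ) (y : Fin m → ℝ) :
    l2 (Bᵀ *ᵥ y) ^ 2 = y ⬝ᵥ ((B * Bᵀ) *ᵥ y) := by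
  rw [l2_sq, ← mulVec_mulVec, dotProduct_mulVec_comm B y]

/-- `Bᵀ Q^{-1/2}` has orthonormal columns, as `Q^{-1/2} Q Q^{-1/2} = 1`. Substituting `y = Q^{-1/2}
u` thus turns estimates relative to `‖Bᵀ y‖` into estimates relative to `‖u‖`. -/
theorem l2_invSqrtGram {B : Matrix (Fin m) (Fin w) ℝ} (hB : ∀ y, Bᵀ *ᵥ y = 0 → y = 0)
    (y : Fin m → ℝ) : l2 (Bᵀ *ᵥ (invSqrtGram B *ᵥ y)) = l2 y := by
  refine (sq_eq_sq₀ (l2_nonneg _) (l2_nonneg _)).mp ?_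
  rw [l2_transpose_mulVec_sq, l2_sq, dotProduct_comm, dotProduct_mulVec_comm,
    invSqrtGram_transpose, mulVec_mulVec, mulVec_mulVec, invSqrtGram_mul_mul hB, one_mulVec]

theorem exists_invSqrtGram_mulVec {B : Matrix (Fin m) (Fin w) ℝ} (hB : ∀ y, Bᵀ *ᵥ y = 0 → y = 0)
    (y : Fin m → ℝ) : ∃ u, invSqrtGram B *ᵥ u = y := by
  have h := invSqrtGram_mul_mul hB
  rw [mul_eq_one_comm] at h
  exact ⟨(invSqrtGram B * (B * Bᵀ)) *ᵥ y, by rw [mulVec_mulVec, h, one_mulVec]⟩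

/-! ### Consequences of an accurate sketch -/

/-- The sketch `W` preserves the row space of `F` up to a factor, and has bounded norm. -/
def SketchGood (F : Matrix (Fin m) (Fin n) ℝ) (W : Matrix (Fin n) (Fin w) ℝ) : Prop :=
  (∀ y, |l2 ((F * W)ᵀ *ᵥ y) ^ 2 - l2 (Fᵀ *ᵥ y) ^ 2| ≤ 1 / 4 * l2 (Fᵀ *ᵥ y) ^ 2) ∧
    ∀ u, l2 (Wᵀ *ᵥ u) ^ 2 ≤ 2 * n * l2 u ^ 2

theorem l2_mulVec_le_specNorm (Z : Matrix (Fin m) (Fin n) ℝ) (u : Fin n → ℝ) :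
    l2 (Z *ᵥ u) ≤ specNorm Z * l2 u := by
  have := (toEuclideanLin Z).toContinuousLinearMap.le_opNorm (WithLp.toLp 2 u)
  simpa [specNorm, l2, toLpLin_apply] using this

theorem specNorm_nonneg (Z : Matrix (Fin m) (Fin n) ℝ) : 0 ≤ specNorm Z := norm_nonneg _

theorem specNorm_le {Z : Matrix (Fin m) (Fin n) ℝ} {c : ℝ} (hc : 0 ≤ c)
    (h : ∀ u, l2 (Z *ᵥ u) ≤ c * l2 u) : specNorm Z ≤ c := by
  refine ContinuousLinearMap.opNorm_le_bound _ hc fun x => ?_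
  have := h x.ofLp
  simpa [l2, toLpLin_apply] using this

theorem frobSq_eq_trace (Z : Matrix (Fin m) (Fin n) ℝ) : frobSq Z = (Z * Zᵀ).trace := by
  simp only [frobSq, Matrix.trace, Matrix.diag_apply, Matrix.mul_apply, transpose_apply, sq]

theorem SketchAccurate.abs_le {ζ : ℝ} {r : ℕ} {Z : Matrix (Fin m) (Fin n) ℝ}
    {W : Matrix (Fin n) (Fin w) ℝ} (h : SketchAccurate ζ r Z W) (u : Fin m → ℝ) :
    |l2 (Wᵀ *ᵥ (Zᵀ *ᵥ u)) ^ 2 - l2 (Zᵀ *ᵥ u) ^ 2| ≤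
      ζ / 4 * (specNorm Z ^ 2 + frobSq Z / r) * l2 u ^ 2 := by
  have h1 : l2 (Wᵀ *ᵥ (Zᵀ *ᵥ u)) ^ 2 - l2 (Zᵀ *ᵥ u) ^ 2
      = u ⬝ᵥ ((Z * W * Wᵀ * Zᵀ - Z * Zᵀ) *ᵥ u) := by
    rw [mulVec_mulVec, ← transpose_mul, l2_transpose_mulVec_sq, l2_transpose_mulVec_sq,
      sub_mulVec, dotProduct_sub, transpose_mul, Matrix.mul_assoc (Z * W)]
  rw [h1]
  have h2 := abs_dotProduct_le_l2 u ((Z * W * Wᵀ * Zᵀ - Z * Zᵀ) *ᵥ u)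
  have h3 := l2_mulVec_le_specNorm (Z * W * Wᵀ * Zᵀ - Z * Zᵀ) u
  have h4 : specNorm (Z * W * Wᵀ * Zᵀ - Z * Zᵀ) ≤ _ := h
  calc _ ≤ _ := h2
    _ ≤ l2 u * (specNorm (Z * W * Wᵀ * Zᵀ - Z * Zᵀ) * l2 u) :=
        mul_le_mul_of_nonneg_left h3 (l2_nonneg u)
    _ = specNorm (Z * W * Wᵀ * Zᵀ - Z * Zᵀ) * l2 u ^ 2 := by ring
    _ ≤ _ := mul_le_mul_of_nonneg_right h4 (sq_nonneg _)

/-- The guarantee is applied to `(F Fᵀ)^{-1/2} F`, whose rows are orthonormal: spectral norm at most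
`1`, squared Frobenius norm `m`. With `ζ = 1/2` the error is at most `1/8 · (1 + 1) = 1/4`. -/
theorem abs_sub_le_of_sketchAccurate {F : Matrix (Fin m) (Fin n) ℝ}
    {W : Matrix (Fin n) (Fin w) ℝ} (hF : ∀ y, Fᵀ *ᵥ y = 0 → y = 0)
    (h : SketchAccurate (1 / 2) m (invSqrtGram F * F) W) (y : Fin m → ℝ) :
    |l2 ((F * W)ᵀ *ᵥ y) ^ 2 - l2 (Fᵀ *ᵥ y) ^ 2| ≤ 1 / 4 * l2 (Fᵀ *ᵥ y) ^ 2 := by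
  obtain ⟨u, rfl⟩ := exists_invSqrtGram_mulVec hF y
  set R := invSqrtGram F with hR
  have hZ : (R * F)ᵀ = Fᵀ * R := by rw [transpose_mul, invSqrtGram_transpose]
  have h1 := h.abs_le u
  rw [hZ, ← mulVec_mulVec] at h1
  rw [transpose_mul, ← mulVec_mulVec, l2_invSqrtGram hF]
  rw [l2_invSqrtGram hF] at h1
  refine h1.trans (mul_le_mul_of_nonneg_right ?_ (sq_nonneg _))
  have hfro : frobSq (R * F) = m := by
    rw [frobSq_eq_trace, hZ, Matrix.mul_assoc, ← Matrix.mul_assoc F, ← Matrix.mul_assoc,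
      invSqrtGram_mul_mul hF, trace_one, Fintype.card_fin]
  have hspec : specNorm (R * F) ≤ 1 := by
    refine specNorm_le zero_le_one fun v => l2_mulVec_le_of_transpose zero_le_one (fun u => ?_) v
    rw [hZ, ← mulVec_mulVec, l2_invSqrtGram hF, one_mul]
  have h2 : specNorm (R * F) ^ 2 ≤ 1 := pow_le_one₀ (specNorm_nonneg _) hspec
  have h3 : frobSq (R * F) / m ≤ 1 := by rw [hfro]; exact div_self_le_one _
  linarith

/-- Taking `Z = 1` bounds `W` itself: `1 + 1/8 · (1 + n/m) ≤ 2n`. The loss of a factor `√n` is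
absorbed by the logarithmic number of solver steps. -/
theorem l2_transpose_sq_le_of_sketchAccurate {W : Matrix (Fin n) (Fin w) ℝ}
    (h : SketchAccurate (1 / 2) m (1 : Matrix (Fin n) (Fin n) ℝ) W) (u : Fin n → ℝ) :
    l2 (Wᵀ *ᵥ u) ^ 2 ≤ 2 * n * l2 u ^ 2 := by
  rcases Nat.eq_zero_or_pos n with rfl | hn
  · have : u = 0 := Subsingleton.elim _ _
    rw [this, mulVec_zero, l2_zero, l2_zero]
    simp
  have hn1 : (1 : ℝ) ≤ n := by exact_mod_cast hn
  have h1 := (_root_.abs_le.mp (h.abs_le u)).2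
  rw [transpose_one, one_mulVec] at h1
  have hspec : specNorm (1 : Matrix (Fin n) (Fin n) ℝ) ≤ 1 :=
    specNorm_le zero_le_one fun v => by rw [one_mulVec, one_mul]
  have h2 : specNorm (1 : Matrix (Fin n) (Fin n) ℝ) ^ 2 ≤ 1 :=
    pow_le_one₀ (specNorm_nonneg _) hspec
  have h3 : frobSq (1 : Matrix (Fin n) (Fin n) ℝ) / m ≤ n := by
    rw [frobSq_eq_trace, transpose_one, Matrix.mul_one, trace_one, Fintype.card_fin]
    rcases Nat.eq_zero_or_pos m with rfl | hm
    · simp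
    · exact div_le_self (by positivity) (by exact_mod_cast hm)
  have h4 : 1 / 2 / 4 * (specNorm (1 : Matrix (Fin n) (Fin n) ℝ) ^ 2 + frobSq (1 : Matrix (Fin n) (Fin n) ℝ) / m) + 1
      ≤ 2 * n := by linarith
  have h5 := mul_le_mul_of_nonneg_right h4 (sq_nonneg (l2 u))
  linarith

/-- The approximate solution of the normal equations and the correction through the
pseudoinverse: the correction reproduces the residual, and is small. -/
theorem correction_bound {F : Matrix (Fin m) (Fin n) ℝ} {W : Matrix (Fin n) (Fin w) ℝ}
    (hF : ∀ y, Fᵀ *ᵥ y = 0 → y = 0) (hW : SketchGood F W) {B : Matrix (Fin w) (Fin m) ℝ}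
    (hB : IsPinv (F * W) B) (sv : Solver) (t : ℕ) (g : Fin n → ℝ) (f : Fin m → ℝ)
    (hf : f = (F * Fᵀ) *ᵥ (invSqrtGram (F * W) *ᵥ sv.run (1 / 2)
      (invSqrtGram (F * W) * (F * Fᵀ) * invSqrtGram (F * W))
      (invSqrtGram (F * W) *ᵥ (F *ᵥ g)) t) - F *ᵥ g) :
    F *ᵥ (W *ᵥ (B *ᵥ f)) = f ∧
      l2 (W *ᵥ (B *ᵥ f)) ≤ Real.sqrt (2 * n) * (4 * (2 / 3) ^ t * l2 g) := by
  set G := F * W with hG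
  have hlow : ∀ y, 3 / 4 * l2 (Fᵀ *ᵥ y) ^ 2 ≤ l2 (Gᵀ *ᵥ y) ^ 2 := fun y => by
    linarith [(abs_le.mp (hW.1 y)).1]
  have hupp : ∀ y, l2 (Gᵀ *ᵥ y) ^ 2 ≤ 5 / 4 * l2 (Fᵀ *ᵥ y) ^ 2 := fun y => by
    linarith [(abs_le.mp (hW.1 y)).2]
  have hGr : ∀ y, Gᵀ *ᵥ y = 0 → y = 0 := fun y hy => hF y (by
    have h1 := hlow y
    rw [hy, l2_zero, l2_sq] at h1
    by_contra h2
    linarith [dotProduct_self_pos h2])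
  set R := invSqrtGram G with hR
  have hRT : Rᵀ = R := invSqrtGram_transpose G
  set M := R * (F * Fᵀ) * R with hM
  have hMT : Mᵀ = M := by
    rw [hM, transpose_mul, transpose_mul, transpose_mul, transpose_transpose, hRT]
    simp only [Matrix.mul_assoc]
  have hMq : ∀ u, u ⬝ᵥ (M *ᵥ u) = l2 (Fᵀ *ᵥ (R *ᵥ u)) ^ 2 := fun u => by
    rw [l2_transpose_mulVec_sq, hM, ← mulVec_mulVec, ← mulVec_mulVec,
      dotProduct_mulVec_comm R u, hRT]
  -- The bounds `4/5` and `4/3` are the reciprocals of the distortions `5/4` and `3/4` of the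
  -- sketch.
  have h1 : ∀ u, 4 / 5 * (u ⬝ᵥ u) ≤ u ⬝ᵥ (M *ᵥ u) := fun u => by
    have := hupp (R *ᵥ u)
    rw [l2_invSqrtGram hGr, l2_sq] at this
    rw [hMq]
    linarith
  have h2 : ∀ u, u ⬝ᵥ (M *ᵥ u) ≤ 4 / 3 * (u ⬝ᵥ u) := fun u => by
    have := hlow (R *ᵥ u)
    rw [l2_invSqrtGram hGr, l2_sq (k := m) u] at this
    rw [hMq]
    linarith
  have hRf : R *ᵥ f = -(R *ᵥ (F *ᵥ g) - M *ᵥ sv.run (1 / 2) M (R *ᵥ (F *ᵥ g)) t) := by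
    rw [hf, mulVec_sub, mulVec_mulVec, mulVec_mulVec, ← hM, neg_sub]
  have hRfl : l2 (R *ᵥ f) ≤ 2 * (2 / 3) ^ t * l2 (R *ᵥ (F *ᵥ g)) := by
    rw [hRf, l2_neg]
    exact sv.residual_le hMT h1 h2 _ t
  have hRg : l2 (R *ᵥ (F *ᵥ g)) ≤ 2 * l2 g := by
    rw [mulVec_mulVec]
    refine l2_mulVec_le_of_transpose zero_le_two (fun u => ?_) g
    rw [transpose_mul, hRT, ← mulVec_mulVec]
    refine abs_le_of_sq_le_sq' ?_ (mul_nonneg zero_le_two (l2_nonneg u)) |>.2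
    rw [← hMq, mul_pow, l2_sq]
    linarith [h2 u, dotProduct_self_nonneg' u]
  have hQ : R * (G * Gᵀ) * R = 1 := invSqrtGram_mul_mul hGr
  have hRQ : R * R * (G * Gᵀ) = 1 := by
    rw [Matrix.mul_assoc] at hQ
    have := mul_eq_one_comm.mp hQ
    rw [Matrix.mul_assoc] at this
    exact mul_eq_one_comm.mp this
  have hQR : G * Gᵀ * (R * R) = 1 := mul_eq_one_comm.mp hRQ
  obtain ⟨hB1, hB2, hB3, hB4⟩ := hB
  -- `G Gᵀ` is invertible with inverse `R²`, so the first Penrose identity makes the pseudoinverse a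
  -- right inverse.
  have hGB : G * B = 1 := by
    calc G * B = G * B * (G * Gᵀ * (R * R)) := by rw [hQR, Matrix.mul_one]
      _ = (G * B * G) * Gᵀ * (R * R) := by simp only [Matrix.mul_assoc]
      _ = 1 := by rw [hB1, hQR]
  have hGBf : G *ᵥ (B *ᵥ f) = f := by rw [mulVec_mulVec, hGB, one_mulVec]
  have hBf : l2 (B *ᵥ f) = l2 (R *ᵥ f) := by
    refine (sq_eq_sq₀ (l2_nonneg _) (l2_nonneg _)).mp ?_
    -- `BᵀB` is the inverse of `G Gᵀ`. Hence `‖B f‖` equals `‖R f‖`, the residual norm that the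
    -- solver controls.
    have h3 : Bᵀ * B = R * R := by
      have h4 : G * Gᵀ * (Bᵀ * B) = 1 := by
        rw [Matrix.mul_assoc, ← Matrix.mul_assoc Gᵀ, ← transpose_mul, hB4, hB2, hGB]
      rw [← Matrix.one_mul (Bᵀ * B), ← hRQ, Matrix.mul_assoc, h4, Matrix.mul_one]
    rw [l2_sq, l2_sq, dotProduct_mulVec_comm, dotProduct_mulVec_comm, mulVec_mulVec,
      mulVec_mulVec, h3, hRT]
  refine ⟨by rw [mulVec_mulVec, ← hG, hGBf], ?_⟩
  have hWn : ∀ v, l2 (W *ᵥ v) ≤ Real.sqrt (2 * n) * l2 v := by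
    refine l2_mulVec_le_of_transpose (Real.sqrt_nonneg _) fun u => ?_
    refine abs_le_of_sq_le_sq' ?_ (mul_nonneg (Real.sqrt_nonneg _) (l2_nonneg u)) |>.2
    rw [mul_pow, Real.sq_sqrt (by positivity)]
    exact hW.2 u
  refine (hWn _).trans (mul_le_mul_of_nonneg_left ?_ (Real.sqrt_nonneg _))
  rw [hBf]
  have : 0 ≤ (2 / 3 : ℝ) ^ t := by positivity
  nlinarith

end Gram

/-! ### Farkas' lemma and complementary slackness -/

/-- **Farkas' lemma** for finitely many linear functionals. -/
theorem farkas {E ι : Type*} [AddCommGroup E] [Module ℝ E] [DecidableEq ι] (s : Finset ι)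
    (A : ι → E →ₗ[ℝ] ℝ) (b : E →ₗ[ℝ] ℝ)
    (h : ∀ x, (∀ i ∈ s, A i x ≤ 0) → b x ≤ 0) :
    ∃ u : ι → ℝ, (∀ i, 0 ≤ u i) ∧ ∀ x, b x = ∑ i ∈ s, u i * A i x := by
  induction s using Finset.induction_on generalizing A b with
  | empty =>
    refine ⟨0, fun _ => le_rfl, fun x => ?_⟩
    have h1 := h x (by simp)
    have h2 := h (-x) (by simp)
    rw [map_neg] at h2
    simp only [Finset.sum_empty]
    linarith
  | insert j s hj ih =>
    by_cases hb : ∀ x, (∀ i ∈ s, A i x ≤ 0) → b x ≤ 0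
    · obtain ⟨u, hu, hub⟩ := ih A b hb
      refine ⟨fun i => if i = j then 0 else u i, fun i => ?_, fun x => ?_⟩
      · dsimp only
        split_ifs
        exacts [le_rfl, hu i]
      · dsimp only
        rw [Finset.sum_insert hj, hub x, if_pos rfl, zero_mul, zero_add]
        refine Finset.sum_congr rfl fun i hi => ?_
        rw [if_neg (ne_of_mem_of_not_mem hi hj)]
    · push Not at hb
      -- The vector `y` violates the conclusion while meeting all constraints but `j`, so `A j y >
      -- 0`. Projecting along `y` onto the kernel of `A j` eliminates that constraint; the
      -- multiplier of `A j` is then forced by evaluating at `y`, and is nonnegative because `A i y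
      -- ≤ 0` on `s`.
      obtain ⟨y, hy, hby⟩ := hb
      have hAj : 0 < A j y := by
        by_contra hneg
        push Not at hneg
        refine absurd (h y fun i hi => ?_) (not_le.mpr hby)
        rcases Finset.mem_insert.mp hi with rfl | hi
        exacts [hneg, hy i hi]
      have key : ∀ (f : E →ₗ[ℝ] ℝ) (x : E),
          f (x - (A j x / A j y) • y) = f x - A j x / A j y * f y := by
        intro f x
        simp
      obtain ⟨u, hu, hub⟩ := ih (fun i => A i - (A i y / A j y) • A j)
        (b - (b y / A j y) • A j) (by
          intro x hx
          have := h (x - (A j x / A j y) • y) (by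
            intro i hi
            rw [key]
            rcases Finset.mem_insert.mp hi with rfl | hi
            · rw [div_mul_cancel₀ _ hAj.ne']; simp
            · have := hx i hi
              simp only [LinearMap.sub_apply, LinearMap.smul_apply, smul_eq_mul] at this
              calc _ = A i x - A i y / A j y * A j x := by ring
                _ ≤ 0 := this)
          rw [key] at this
          simp only [LinearMap.sub_apply, LinearMap.smul_apply, smul_eq_mul]
          calc _ = b x - A j x / A j y * b y := by ring
            _ ≤ 0 := this)
      refine ⟨fun i => if i = j then (b y - ∑ i ∈ s, u i * A i y) / A j y else u i,
        fun i => ?_, fun x => ?_⟩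
      · dsimp only
        split_ifs
        · refine div_nonneg ?_ hAj.le
          have : ∑ i ∈ s, u i * A i y ≤ 0 :=
            Finset.sum_nonpos fun i hi => mul_nonpos_of_nonneg_of_nonpos (hu i) (hy i hi)
          linarith
        · exact hu i
      · have h1 := hub x
        simp only [LinearMap.sub_apply, LinearMap.smul_apply, smul_eq_mul, mul_sub,
          Finset.sum_sub_distrib] at h1
        have h2 : ∑ i ∈ s, u i * (A i y / A j y * A j x)
            = (∑ i ∈ s, u i * A i y) / A j y * A j x := by
          rw [Finset.sum_div, Finset.sum_mul]
          exact Finset.sum_congr rfl fun i _ => by ring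
        have h3 : ∑ i ∈ s, (if i = j then (b y - ∑ i ∈ s, u i * A i y) / A j y else u i) * A i x
            = ∑ i ∈ s, u i * A i x :=
          Finset.sum_congr rfl fun i hi => by rw [if_neg (ne_of_mem_of_not_mem hi hj)]
        dsimp only
        rw [Finset.sum_insert hj, if_pos rfl, h3]
        rw [h2] at h1
        rw [sub_div, sub_mul]
        linarith

/-- Optimal primal and dual solutions are complementary. -/
theorem optimal_complementary {m n : ℕ} (L : LinProg m n) {z : Point m n}
    (hz : z ∈ L.optimalSet) : z.x ⬝ᵥ z.s = 0 := by
  obtain ⟨⟨hp, hpo⟩, hd, hdo⟩ := hz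
  set v := L.c ⬝ᵥ z.x with hv
  have weak : z.x ⬝ᵥ z.s = v - L.b ⬝ᵥ z.y := by
    have : z.s = L.c - L.Aᵀ *ᵥ z.y := by rw [← hd.1]; simp
    rw [this, dotProduct_sub, dotProduct_mulVec_comm, transpose_transpose, hp.1, hv,
      dotProduct_comm L.c]
  have hnn : 0 ≤ z.x ⬝ᵥ z.s := Finset.sum_nonneg fun i _ => mul_nonneg (hp.2 i) (hd.2 i)
  let fx : (Fin n → ℝ) × ℝ →ₗ[ℝ] (Fin n → ℝ) := LinearMap.fst ℝ _ _
  let ft : (Fin n → ℝ) × ℝ →ₗ[ℝ] ℝ := LinearMap.snd ℝ _ _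
  let fr : Fin m → (Fin n → ℝ) × ℝ →ₗ[ℝ] ℝ := fun j =>
    (LinearMap.proj j ∘ₗ L.A.mulVecLin ∘ₗ fx) - L.b j • ft
  let fc : (Fin n → ℝ) × ℝ →ₗ[ℝ] ℝ := dotProductBilin ℝ ℝ L.c ∘ₗ fx
  let F : (Fin n ⊕ Fin m) ⊕ (Fin m ⊕ Unit) → (Fin n → ℝ) × ℝ →ₗ[ℝ] ℝ :=
    Sum.elim (Sum.elim (fun i => -(LinearMap.proj i ∘ₗ fx)) fr)
      (Sum.elim (fun j => -fr j) (fun _ => -ft))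
  -- Strong duality by homogenisation: on the cone `x ≥ 0`, `A x = τ b`, `τ ≥ 0`, primal optimality
  -- gives `v τ ≤ cᵀx`. Each equation enters as two inequalities.
  obtain ⟨u, hu, hub⟩ := farkas Finset.univ F (v • ft - fc) (by
    rintro ⟨x, τ⟩ h
    have hx : ∀ i, 0 ≤ x i := fun i => by
      simpa [F, fx] using h (.inl (.inl i)) (Finset.mem_univ _)
    have hA : L.A *ᵥ x = τ • L.b := by
      ext j
      have h1 := h (.inl (.inr j)) (Finset.mem_univ _)
      have h2 := h (.inr (.inl j)) (Finset.mem_univ _)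
      simp only [F, fr, fx, ft, Sum.elim_inl, Sum.elim_inr, LinearMap.neg_apply,
        LinearMap.sub_apply, LinearMap.comp_apply, LinearMap.smul_apply, LinearMap.fst_apply,
        LinearMap.snd_apply, LinearMap.proj_apply, Matrix.mulVecLin_apply, smul_eq_mul] at h1 h2
      rw [Pi.smul_apply, smul_eq_mul]
      linarith [mul_comm τ (L.b j)]
    have hτ : 0 ≤ τ := by
      simpa [F, ft] using h (.inr (.inr ())) (Finset.mem_univ _)
    have goal : v * τ ≤ L.c ⬝ᵥ x := by
      -- For `τ = 0` the vector `x` is a recession direction and is added to the optimum; for `τ >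
      -- 0` it is rescaled to a feasible point.
      rcases hτ.eq_or_lt with h0 | h0
      · have := hpo (z.x + x) ⟨by rw [mulVec_add, hA, ← h0, hp.1]; simp,
          fun i => add_nonneg (hp.2 i) (hx i)⟩
        rw [dotProduct_add] at this
        rw [← h0]
        linarith
      · have := hpo (τ⁻¹ • x) ⟨by rw [mulVec_smul, hA, smul_smul, inv_mul_cancel₀ h0.ne', one_smul],
          fun i => mul_nonneg (inv_nonneg.mpr hτ) (hx i)⟩
        rw [dotProduct_smul, smul_eq_mul, ← div_eq_inv_mul, le_div_iff₀ h0] at this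
        exact this
    have : (v • ft - fc) (x, τ) = v * τ - L.c ⬝ᵥ x := by simp [ft, fc, fx]
    rw [this]
    linarith)
  -- The dual certificate. Evaluating the identity at `(0, 1)` gives its objective value, and at
  -- `(eᵢ, 0)` its feasibility.
  let y : Fin m → ℝ := fun j => u (.inr (.inl j)) - u (.inl (.inr j))
  have expand : ∀ (x : Fin n → ℝ) (τ : ℝ), v * τ - L.c ⬝ᵥ x =
      -(∑ i, u (.inl (.inl i)) * x i) - y ⬝ᵥ (L.A *ᵥ x - τ • L.b) - u (.inr (.inr ())) * τ := by
    intro x τ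
    have h1 : (v • ft - fc) (x, τ) = v * τ - L.c ⬝ᵥ x := by simp [ft, fc, fx]
    rw [← h1, hub]
    simp only [Fintype.sum_sum_type, F, fr, fx, ft, Sum.elim_inl, Sum.elim_inr,
      LinearMap.neg_apply, LinearMap.sub_apply, LinearMap.comp_apply, LinearMap.smul_apply,
      LinearMap.fst_apply, LinearMap.snd_apply, LinearMap.proj_apply, Matrix.mulVecLin_apply,
      smul_eq_mul, dotProduct, y, Pi.sub_apply, Pi.smul_apply, Finset.univ_unique,
      Finset.sum_singleton, PUnit.default_eq_unit, sub_mul, mul_sub, mul_neg, Finset.sum_neg_distrib,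
      Finset.sum_sub_distrib, mul_comm τ]
    ring
  have hbv : v ≤ L.b ⬝ᵥ y := by
    have := expand 0 1
    simp only [mul_one, dotProduct_zero, sub_zero, Pi.zero_apply, mul_zero, Finset.sum_const_zero,
      neg_zero, mulVec_zero, one_smul, zero_sub, dotProduct_neg, neg_neg] at this
    rw [dotProduct_comm L.b]
    linarith [hu (.inr (.inr ()))]
  have hdf : L.DualFeasible y (L.c - L.Aᵀ *ᵥ y) := by
    refine ⟨by simp, fun i => ?_⟩
    have h1 := expand (Pi.single i 1) 0
    rw [zero_smul, sub_zero, dotProduct_mulVec_comm] at h1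
    simp only [mul_zero, dotProduct_single, mul_one, Pi.single_apply, mul_ite, Finset.sum_ite_eq',
      Finset.mem_univ, if_true] at h1
    simp only [Pi.sub_apply]
    linarith [hu (.inl (.inl i))]
  have := hdo _ _ hdf
  linarith

/-! ### Bounds on the search direction -/

section Bounds

variable {n : ℕ}

theorem l2_div_le {e : Fin n → ℝ} {κ : ℝ} (he : ∀ i, 0 < e i) (hκ : ∀ i, (e i)⁻¹ ≤ κ)
    (hκ0 : 0 ≤ κ) (u : Fin n → ℝ) : l2 (fun i => u i / e i) ≤ κ * l2 u := by
  rw [← abs_of_nonneg hκ0, ← l2_smul]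
  refine l2_le_of_sq_le (l2_nonneg _) ?_
  rw [l2_sq]
  refine Finset.sum_le_sum fun i _ => ?_
  have h1 : 0 < (e i)⁻¹ := inv_pos.mpr (he i)
  have h2 : (e i)⁻¹ * (e i)⁻¹ ≤ κ * κ := mul_self_le_mul_self h1.le (hκ i)
  have h3 := mul_le_mul_of_nonneg_right h2 (mul_self_nonneg (u i))
  simp only [Pi.smul_apply, smul_eq_mul, div_eq_mul_inv]
  calc _ = (e i)⁻¹ * (e i)⁻¹ * (u i * u i) := by ring
    _ ≤ _ := h3
    _ = _ := by ring

theorem l2_const_le {n : ℕ} (a : ℝ) : l2 (fun _ : Fin n => a) ≤ n * |a| := by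
  refine (l2_le_sum_abs _).trans ?_
  simp

/-- Positive vectors `x`, `s` with duality measure `μ`, and all products `x i * s i` comparable
to `μ`. -/
structure Central (Λ μ : ℝ) (x s : Fin n → ℝ) : Prop where
  pos : 0 < n
  one_le : 1 ≤ Λ
  mu_pos : 0 < μ
  x_pos : ∀ i, 0 < x i
  s_pos : ∀ i, 0 < s i
  sum_eq : x ⬝ᵥ s = n * μ
  le_mul : ∀ i, μ ≤ Λ * (x i * s i)

namespace Central

variable {Λ μ : ℝ} {x s : Fin n → ℝ}

theorem one_le_card (h : Central Λ μ x s) : (1 : ℝ) ≤ n := by exact_mod_cast h.pos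

theorem sqrt_pos (h : Central Λ μ x s) (i : Fin n) : 0 < Real.sqrt (x i * s i) :=
  Real.sqrt_pos.mpr (mul_pos (h.x_pos i) (h.s_pos i))

theorem mul_self_sqrt (h : Central Λ μ x s) (i : Fin n) :
    Real.sqrt (x i * s i) * Real.sqrt (x i * s i) = x i * s i :=
  Real.mul_self_sqrt (mul_pos (h.x_pos i) (h.s_pos i)).le

/-- Bounds in scaled coordinates are measured in units of `κ μ = √(Λμ)`, where `κ = √(Λ/μ)`; this
identity removes `κ` at the end. -/
theorem kappa_sq (h : Central Λ μ x s) : Real.sqrt (Λ / μ) ^ 2 * μ = Λ := by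
  rw [Real.sq_sqrt (div_nonneg (zero_le_one.trans h.one_le) h.mu_pos.le),
    div_mul_cancel₀ _ h.mu_pos.ne']

theorem inv_sqrt_le (h : Central Λ μ x s) (i : Fin n) :
    (Real.sqrt (x i * s i))⁻¹ ≤ Real.sqrt (Λ / μ) := by
  rw [← Real.sqrt_inv]
  refine Real.sqrt_le_sqrt ?_
  rw [inv_le_iff_one_le_mul₀ (mul_pos (h.x_pos i) (h.s_pos i)), div_mul_eq_mul_div,
    le_div_iff₀ h.mu_pos, one_mul]
  exact h.le_mul i

theorem l2_div_sqrt_le (h : Central Λ μ x s) (u : Fin n → ℝ) :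
    l2 (fun i => u i / Real.sqrt (x i * s i)) ≤ Real.sqrt (Λ / μ) * l2 u :=
  l2_div_le h.sqrt_pos h.inv_sqrt_le (Real.sqrt_nonneg _) u

theorem l2_sqrt_sq (h : Central Λ μ x s) :
    l2 (fun i => Real.sqrt (x i * s i)) ^ 2 = n * μ := by
  rw [l2_sq, ← h.sum_eq]
  exact Finset.sum_congr rfl fun i _ => h.mul_self_sqrt i

/-- The norm is exactly `√(nμ)`; the coarser bound brings it to the unit shared by the other terms.
-/
theorem l2_sqrt_le (h : Central Λ μ x s) :
    l2 (fun i => Real.sqrt (x i * s i)) ≤ n * (Real.sqrt (Λ / μ) * μ) := by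
  have hμ := h.mu_pos
  refine abs_le_of_sq_le_sq' ?_ (by positivity) |>.2
  rw [h.l2_sqrt_sq]
  have h1 : ((n : ℝ) * (Real.sqrt (Λ / μ) * μ)) ^ 2 = (n * μ) * (n * Λ) := by
    calc _ = (n : ℝ) ^ 2 * μ * (Real.sqrt (Λ / μ) ^ 2 * μ) := by ring
      _ = _ := by rw [h.kappa_sq]; ring
  rw [h1]
  refine le_mul_of_one_le_right (by positivity) ?_
  nlinarith [h.one_le_card, h.one_le]

theorem l2_mu_div_le (h : Central Λ μ x s) {σ : ℝ} (hσ0 : 0 ≤ σ) (hσ1 : σ ≤ 1) :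
    l2 (fun i => σ * μ / Real.sqrt (x i * s i)) ≤ n * (Real.sqrt (Λ / μ) * μ) := by
  have hμ := h.mu_pos
  refine (h.l2_div_sqrt_le fun _ => σ * μ).trans ?_
  have h1 := l2_const_le (n := n) (σ * μ)
  rw [abs_of_nonneg (by positivity)] at h1
  calc _ ≤ Real.sqrt (Λ / μ) * (n * (σ * μ)) := mul_le_mul_of_nonneg_left h1 (Real.sqrt_nonneg _)
    _ ≤ Real.sqrt (Λ / μ) * (n * (1 * μ)) := by gcongr
    _ = _ := by ring

theorem l2_sum_div_le (h : Central Λ μ x s) {u : Fin n → ℝ} {c : ℝ} (hu : ∑ i, |u i| ≤ c) :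
    l2 (fun i => u i / Real.sqrt (x i * s i)) ≤ Real.sqrt (Λ / μ) * c :=
  (h.l2_div_sqrt_le u).trans
    (mul_le_mul_of_nonneg_left ((l2_le_sum_abs u).trans hu) (Real.sqrt_nonneg _))

/-- Solutions of the (perturbed) scaled Newton equations are small relative to the iterate. -/
theorem scaled_direction_bounds (h : Central Λ μ x s) {p q v dx ds : Fin n → ℝ} {σ : ℝ}
    (hσ0 : 0 ≤ σ) (hσ1 : σ ≤ 1) (hp : ∀ i, 0 ≤ p i) (hq : ∀ i, 0 ≤ q i)
    (hpq : s ⬝ᵥ p + x ⬝ᵥ q ≤ 3 * n * μ) (hv : l2 v ≤ μ)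
    (heq : ∀ i, s i * dx i + x i * ds i = -(x i * s i) + σ * μ - v i)
    (horth : (dx + p) ⬝ᵥ (ds + q) = 0) :
    l2 (fun i => s i * dx i / Real.sqrt (x i * s i)) ≤ 9 * n * (Real.sqrt (Λ / μ) * μ) ∧
      l2 (fun i => x i * ds i / Real.sqrt (x i * s i)) ≤ 9 * n * (Real.sqrt (Λ / μ) * μ) := by
  set e : Fin n → ℝ := fun i => Real.sqrt (x i * s i) with he
  set κ := Real.sqrt (Λ / μ) with hκ
  have hμ := h.mu_pos
  have hκ0 : 0 ≤ κ := Real.sqrt_nonneg _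
  have he0 : ∀ i, 0 < e i := h.sqrt_pos
  have hee : ∀ i, e i * e i = x i * s i := h.mul_self_sqrt
  have hsp : 0 ≤ s ⬝ᵥ p := Finset.sum_nonneg fun i _ => mul_nonneg (h.s_pos i).le (hp i)
  have hxq : 0 ≤ x ⬝ᵥ q := Finset.sum_nonneg fun i _ => mul_nonneg (h.x_pos i).le (hq i)
  have habs_p : ∑ i, |s i * p i| = s ⬝ᵥ p :=
    Finset.sum_congr rfl fun i _ => abs_of_nonneg (mul_nonneg (h.s_pos i).le (hp i))
  have habs_q : ∑ i, |x i * q i| = x ⬝ᵥ q :=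
    Finset.sum_congr rfl fun i _ => abs_of_nonneg (mul_nonneg (h.x_pos i).le (hq i))
  set P : Fin n → ℝ := fun i => s i * p i / e i with hP
  set Q : Fin n → ℝ := fun i => x i * q i / e i with hQ
  have hPl : l2 P ≤ κ * (s ⬝ᵥ p) := h.l2_sum_div_le habs_p.le
  have hQl : l2 Q ≤ κ * (x ⬝ᵥ q) := h.l2_sum_div_le habs_q.le
  set a : Fin n → ℝ := fun i => s i * (dx i + p i) / e i with ha
  set b : Fin n → ℝ := fun i => x i * (ds i + q i) / e i with hb
  -- The scaling multiplies one factor by `√(s/x)` and the other by `√(x/s)`, so inner products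
  -- survive.
  have hab : a ⬝ᵥ b = 0 := by
    rw [← horth]
    refine Finset.sum_congr rfl fun i _ => ?_
    simp only [ha, hb, Pi.add_apply]
    rw [div_mul_div_comm, hee]
    have := (h.x_pos i).ne'
    have := (h.s_pos i).ne'
    field_simp
  have hsum : a + b = (P + Q) + ((fun i => σ * μ / e i) - e - fun i => v i / e i) := by
    ext i
    have h1 := heq i
    have h2 := (he0 i).ne'
    simp only [ha, hb, hP, hQ, Pi.add_apply, Pi.sub_apply]
    field_simp
    rw [sq, hee]
    linarith
  have hv' : l2 (fun i => v i / e i) ≤ κ * μ :=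
    (h.l2_div_sqrt_le v).trans (mul_le_mul_of_nonneg_left hv hκ0)
  have hn := h.one_le_card
  have hκμ : 0 ≤ κ * μ := by positivity
  have hκn : κ * μ ≤ n * (κ * μ) := le_mul_of_one_le_left hκμ hn
  have hPQ : l2 P + l2 Q ≤ 3 * (n * (κ * μ)) := by
    have := mul_le_mul_of_nonneg_left hpq hκ0
    linarith
  -- Of the `6` units, `P` and `Q` contribute three, and the centring term, `e` and `v` one each.
  -- Removing `P` or `Q` afterwards costs three more, hence `9`.
  have hab_le : l2 (a + b) ≤ 6 * (n * (κ * μ)) := by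
    rw [hsum]
    have h1 := l2_add_le (P + Q) ((fun i => σ * μ / e i) - e - fun i => v i / e i)
    have h2 := l2_add_le P Q
    have h3 := l2_sub_le ((fun i => σ * μ / e i) - e) (fun i => v i / e i)
    have h4 := l2_sub_le (fun i => σ * μ / e i) e
    have h5 : l2 (fun i => σ * μ / e i) ≤ _ := h.l2_mu_div_le hσ0 hσ1
    have h6 : l2 e ≤ _ := h.l2_sqrt_le
    linarith
  have hpyth : l2 (a + b) ^ 2 = l2 a ^ 2 + l2 b ^ 2 := by
    simp only [l2_sq, add_dotProduct, dotProduct_add, hab, dotProduct_comm b a]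
    ring
  have ha_le : l2 a ≤ l2 (a + b) :=
    abs_le_of_sq_le_sq' (by linarith [sq_nonneg (l2 b)]) (l2_nonneg _) |>.2
  have hb_le : l2 b ≤ l2 (a + b) :=
    abs_le_of_sq_le_sq' (by linarith [sq_nonneg (l2 a)]) (l2_nonneg _) |>.2
  have hda : (fun i => s i * dx i / e i) = a - P := by
    ext i
    simp only [ha, hP, Pi.sub_apply]
    ring
  have hdb : (fun i => x i * ds i / e i) = b - Q := by
    ext i
    simp only [hb, hQ, Pi.sub_apply]
    ring
  rw [hda, hdb]
  constructor
  · linarith [l2_sub_le a P, l2_nonneg Q]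
  · linarith [l2_sub_le b Q, l2_nonneg P]

/-- Centrality gives `√(xᵢsᵢ) ≤ κ xᵢsᵢ`, which converts the scaled bounds into relative ones.
Products of the scaled components equal `Δxᵢ Δsᵢ`, and `(9nκμ)² = 81 n² Λ μ`. -/
theorem direction_bounds (h : Central Λ μ x s) {dx ds : Fin n → ℝ}
    (h1 : l2 (fun i => s i * dx i / Real.sqrt (x i * s i)) ≤ 9 * n * (Real.sqrt (Λ / μ) * μ))
    (h2 : l2 (fun i => x i * ds i / Real.sqrt (x i * s i)) ≤ 9 * n * (Real.sqrt (Λ / μ) * μ)) :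
    (∀ i, |dx i| ≤ 9 * n * Λ * x i) ∧ (∀ i, |ds i| ≤ 9 * n * Λ * s i) ∧
      (∀ i, |dx i * ds i| ≤ 81 * n ^ 2 * Λ * μ) ∧ |dx ⬝ᵥ ds| ≤ 81 * n ^ 2 * Λ * μ := by
  set κ := Real.sqrt (Λ / μ) with hκ
  have hμ := h.mu_pos
  have hκ0 : 0 ≤ κ := Real.sqrt_nonneg _
  set a : Fin n → ℝ := fun i => s i * dx i / Real.sqrt (x i * s i) with ha
  set b : Fin n → ℝ := fun i => x i * ds i / Real.sqrt (x i * s i) with hb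
  have hprod : ∀ i, a i * b i = dx i * ds i := fun i => by
    simp only [ha, hb]
    rw [div_mul_div_comm, h.mul_self_sqrt]
    have := (h.x_pos i).ne'
    have := (h.s_pos i).ne'
    field_simp
  have hC : (9 * n * (κ * μ)) * (9 * n * (κ * μ)) = 81 * n ^ 2 * Λ * μ := by
    calc _ = 81 * (n : ℝ) ^ 2 * (κ ^ 2 * μ) * μ := by ring
      _ = _ := by rw [hκ, h.kappa_sq]
  have hscale : ∀ (u r d : ℝ) (i : Fin n), 0 < u → 0 < r → x i * s i = u * r →
      |r * d / Real.sqrt (x i * s i)| ≤ 9 * n * (κ * μ) → |d| ≤ 9 * n * Λ * u := by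
    intro u r d i hu hr hur hle
    have he := h.sqrt_pos i
    have hee := h.mul_self_sqrt i
    have hinv := h.inv_sqrt_le i
    rw [abs_div, abs_of_pos he, div_le_iff₀ he, abs_mul, abs_of_pos hr] at hle
    have h3 : Real.sqrt (x i * s i) ≤ κ * (u * r) := by
      rw [inv_le_iff_one_le_mul₀ he] at hinv
      calc Real.sqrt (x i * s i) ≤ κ * Real.sqrt (x i * s i) * Real.sqrt (x i * s i) :=
            le_mul_of_one_le_left he.le hinv
        _ = κ * (u * r) := by rw [mul_assoc, hee, hur]
    have h4 : r * |d| ≤ r * (9 * n * Λ * u) := by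
      calc r * |d| ≤ 9 * n * (κ * μ) * (κ * (u * r)) :=
            hle.trans (mul_le_mul_of_nonneg_left h3 (by positivity))
        _ = 9 * n * (κ ^ 2 * μ) * u * r := by ring
        _ = _ := by rw [hκ, h.kappa_sq]; ring
    exact le_of_mul_le_mul_left h4 hr
  refine ⟨fun i => ?_, fun i => ?_, fun i => ?_, ?_⟩
  · exact hscale _ _ _ i (h.x_pos i) (h.s_pos i) rfl ((abs_apply_le_l2 a i).trans h1)
  · exact hscale _ _ _ i (h.s_pos i) (h.x_pos i) (mul_comm _ _) ((abs_apply_le_l2 b i).trans h2)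
  · rw [← hprod, abs_mul, ← hC]
    exact mul_le_mul ((abs_apply_le_l2 a i).trans h1) ((abs_apply_le_l2 b i).trans h2)
      (abs_nonneg _) (by positivity)
  · have : dx ⬝ᵥ ds = a ⬝ᵥ b := Finset.sum_congr rfl fun i _ => (hprod i).symm
    rw [this, ← hC]
    exact (abs_dotProduct_le_l2 a b).trans (mul_le_mul h1 h2 (l2_nonneg _) (by positivity))

/-- Along a short step in the Newton direction the products stay comparable to the duality
measure, which decreases, but no faster than linearly. -/
theorem short_step (h : Central Λ μ x s) {v dx ds : Fin n → ℝ} {σ γ α : ℝ}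
    (hγ : 0 < γ) (hγ1 : γ < 1) (hσ : 0 < σ) (hσ1 : σ < 4 / 5) (hγΛ : 1 ≤ Λ * γ)
    (hσΛ : 1 ≤ Λ * σ) (hcen : ∀ i, (1 - γ) * μ ≤ x i * s i)
    (hv : l2 v ≤ μ / (16 * Λ ^ 2))
    (heq : ∀ i, s i * dx i + x i * ds i = -(x i * s i) + σ * μ - v i)
    (hdx : ∀ i, |dx i| ≤ 9 * n * Λ * x i) (hds : ∀ i, |ds i| ≤ 9 * n * Λ * s i)
    (hdd : ∀ i, |dx i * ds i| ≤ 81 * n ^ 2 * Λ * μ) (hdot : |dx ⬝ᵥ ds| ≤ 81 * n ^ 2 * Λ * μ)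
    (hα0 : 0 ≤ α) (hα : α * (2000 * Λ ^ 3 * n ^ 2) ≤ 1) :
    (∀ i, 0 < x i + α * dx i) ∧ (∀ i, 0 < s i + α * ds i) ∧
      (∀ i, (1 - γ) * (((x + α • dx) ⬝ᵥ (s + α • ds)) / n) ≤ (x i + α * dx i) * (s i + α * ds i)) ∧
      (1 - α) * μ ≤ ((x + α • dx) ⬝ᵥ (s + α • ds)) / n ∧
      ((x + α • dx) ⬝ᵥ (s + α • ds)) / n ≤ (1 - α / 20) * μ := by
  have hn := h.one_le_card
  have hn0 : (0 : ℝ) < n := zero_lt_one.trans_le hn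
  have hμ := h.mu_pos
  have hΛ := h.one_le
  have hΛ0 : 0 < Λ := zero_lt_one.trans_le hΛ
  have hσγ : 1 ≤ Λ ^ 2 * (σ * γ) := by
    calc (1 : ℝ) ≤ (Λ * γ) * (Λ * σ) := one_le_mul_of_one_le_of_one_le hγΛ hσΛ
      _ = _ := by ring
  have hΛ2 : 1 ≤ Λ ^ 2 := one_le_pow₀ hΛ
  -- all error terms are controlled by `τ = 1 / (16 Λ²)`
  set τ : ℝ := 1 / (16 * Λ ^ 2) with hτ
  have hτ0 : 0 < τ := by positivity
  have hτ1 : τ ≤ 1 / 16 := by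
    rw [hτ]
    exact one_div_le_one_div_of_le (by norm_num) (by linarith)
  have hτσ : 16 * τ ≤ σ * γ := by
    rw [hτ, mul_one_div, div_le_iff₀ (by positivity)]
    linarith
  have hv1 : ∀ i, |v i| ≤ τ * μ := fun i =>
    (abs_apply_le_l2 v i).trans (hv.trans_eq (by rw [hτ]; ring))
  have hvs : |∑ i, v i| ≤ n * (τ * μ) := by
    refine (Finset.abs_sum_le_sum_abs _ _).trans ((Finset.sum_le_sum fun i _ => hv1 i).trans ?_)
    simp
  -- The step bound turns second-order terms into at most `τ μ`, with room to spare: `2000 / 16 =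
  -- 125 ≥ 81`.
  have hαdd : α * (81 * n ^ 2 * Λ * μ) ≤ τ * μ := by
    have : α * (2000 * Λ ^ 3 * n ^ 2) * (τ * μ) ≤ 1 * (τ * μ) :=
      mul_le_mul_of_nonneg_right hα (by positivity)
    have h2 : α * (2000 * Λ ^ 3 * n ^ 2) * (τ * μ) = α * (125 * n ^ 2 * Λ * μ) := by
      rw [hτ]; field_simp; ring
    rw [h2, one_mul] at this
    refine le_trans ?_ this
    have : 0 ≤ α * (n ^ 2 * Λ * μ) := by positivity
    linarith
  have hsum : ((x + α • dx) ⬝ᵥ (s + α • ds)) =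
      n * μ + α * (-(n * μ) + n * (σ * μ) - ∑ i, v i) + α * (α * (dx ⬝ᵥ ds)) := by
    have h1 : s ⬝ᵥ dx + x ⬝ᵥ ds = -(n * μ) + n * (σ * μ) - ∑ i, v i := by
      have h2 : s ⬝ᵥ dx + x ⬝ᵥ ds = ∑ i, (-(x i * s i) + σ * μ - v i) := by
        rw [← Finset.sum_congr rfl fun i _ => heq i, Finset.sum_add_distrib]
        rfl
      rw [h2, ← h.sum_eq, Finset.sum_sub_distrib, Finset.sum_add_distrib, Finset.sum_neg_distrib]
      simp [dotProduct]
    rw [← h1, ← h.sum_eq]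
    simp only [add_dotProduct, dotProduct_add, smul_dotProduct, dotProduct_smul, smul_eq_mul,
      dotProduct_comm dx s]
    ring
  set ν := ((x + α • dx) ⬝ᵥ (s + α • ds)) / n with hν
  set ω := (dx ⬝ᵥ ds) / n with hω
  set ψ := (∑ i, v i) / n with hψ
  have hν' : ν = (1 - α) * μ + α * (σ * μ) - α * ψ + α * (α * ω) := by
    rw [hν, hsum, hψ, hω]
    field_simp
    ring
  have hψ' : |ψ| ≤ τ * μ := by
    rw [hψ, abs_div, abs_of_pos hn0, div_le_iff₀ hn0]
    linarith
  have hω' : α * |ω| ≤ τ * μ := by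
    rw [hω, abs_div, abs_of_pos hn0]
    refine le_trans (mul_le_mul_of_nonneg_left ?_ hα0) hαdd
    exact (div_le_self (abs_nonneg _) hn).trans hdot
  have hωα : |α * ω| ≤ τ * μ := by rwa [abs_mul, abs_of_nonneg hα0]
  obtain ⟨hψ1, hψ2⟩ := abs_le.mp hψ'
  obtain ⟨hω1, hω2⟩ := abs_le.mp hωα
  have hα1 : α ≤ 1 := by
    have : (1 : ℝ) ≤ 2000 * Λ ^ 3 * n ^ 2 := by
      have h1 : (1 : ℝ) ≤ Λ ^ 3 * n ^ 2 :=
        one_le_mul_of_one_le_of_one_le (one_le_pow₀ hΛ) (one_le_pow₀ hn)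
      linarith
    exact (le_mul_of_one_le_right hα0 this).trans hα
  have hsmall : α * (9 * n * Λ) ≤ 1 / 2 := by
    have h1 : n * Λ ≤ Λ ^ 3 * n ^ 2 := by
      have h2 : (1 : ℝ) ≤ Λ ^ 2 * n := one_le_mul_of_one_le_of_one_le hΛ2 hn
      calc (n * Λ : ℝ) ≤ n * Λ * (Λ ^ 2 * n) := le_mul_of_one_le_right (by positivity) h2
        _ = _ := by ring
    have h3 := mul_le_mul_of_nonneg_left h1 hα0
    linarith
  have hpos : ∀ u d : ℝ, 0 < u → |d| ≤ 9 * n * Λ * u → 0 < u + α * d := by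
    intro u d hu hd
    have h1 : α * |d| ≤ 1 / 2 * u :=
      calc α * |d| ≤ α * (9 * n * Λ * u) := mul_le_mul_of_nonneg_left hd hα0
        _ = α * (9 * n * Λ) * u := by ring
        _ ≤ 1 / 2 * u := mul_le_mul_of_nonneg_right hsmall hu.le
    have h2 : -(α * |d|) ≤ α * d := by
      rw [← mul_neg]
      exact mul_le_mul_of_nonneg_left (neg_abs_le d) hα0
    linarith
  have hσ16 : 16 * τ ≤ σ := hτσ.trans (mul_le_of_le_one_right hσ.le hγ1.le)
  have hmono : 0 ≤ α * ((σ - 2 * τ) * μ) := mul_nonneg hα0 (mul_nonneg (by linarith) hμ.le)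
  refine ⟨fun i => hpos _ _ (h.x_pos i) (hdx i), fun i => hpos _ _ (h.s_pos i) (hds i), fun i => ?_,
    ?_, ?_⟩
  -- Subtracting `(1 - γ)` times the new duality measure leaves, besides `(1 - α)` times the old
  -- slack, the gain `α γ σ μ ≥ 16 α τ μ`. The errors total at most `4 α τ μ`.
  · have h1 := heq i
    have h2 : (x i + α * dx i) * (s i + α * ds i) =
        (1 - α) * (x i * s i) + α * (σ * μ) - α * v i + α * (α * (dx i * ds i)) := by
      linear_combination α * h1
    rw [h2, hν']
    have h3 : (1 - α) * ((1 - γ) * μ) ≤ (1 - α) * (x i * s i) :=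
      mul_le_mul_of_nonneg_left (hcen i) (by linarith)
    have h4 : |α * (dx i * ds i)| ≤ τ * μ := by
      rw [abs_mul, abs_of_nonneg hα0]
      exact (mul_le_mul_of_nonneg_left (hdd i) hα0).trans hαdd
    have h5 := (abs_le.mp (hv1 i)).2
    have h6 := (abs_le.mp h4).1
    have hγ' : 0 ≤ 1 - γ := by linarith
    have h7 : (1 - γ) * (-ψ + α * ω) ≤ 2 * (τ * μ) := by
      have h8 : -ψ + α * ω ≤ 2 * (τ * μ) := by linarith
      have h9 : 0 ≤ 2 * (τ * μ) := by positivity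
      exact (mul_le_mul_of_nonneg_left h8 hγ').trans (mul_le_of_le_one_left h9 (by linarith))
    have h10 : 16 * τ * μ ≤ σ * γ * μ := mul_le_mul_of_nonneg_right hτσ hμ.le
    have h11 : 0 ≤ γ * (σ * μ) - v i + α * (dx i * ds i) - (1 - γ) * (-ψ + α * ω) := by
      have : 0 ≤ τ * μ := by positivity
      linarith
    have h12 := mul_nonneg hα0 h11
    linarith
  · rw [hν']
    have h1 : 0 ≤ σ * μ - ψ + α * ω := by
      have : 16 * τ * μ ≤ σ * μ := mul_le_mul_of_nonneg_right hσ16 hμ.le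
      have : 0 ≤ τ * μ := by positivity
      linarith
    have := mul_nonneg hα0 h1
    linarith
  · rw [hν']
    -- The margin is `1 - 1/20 - 4/5 = 3/20`, against errors of `2τ ≤ 1/8`.
    have h1 : 0 ≤ (1 - 1 / 20) * μ - σ * μ + ψ - α * ω := by
      have h2 : τ * μ ≤ 1 / 16 * μ := mul_le_mul_of_nonneg_right hτ1 hμ.le
      have h3 : σ * μ ≤ 4 / 5 * μ := mul_le_mul_of_nonneg_right hσ1.le hμ.le
      linarith
    have := mul_nonneg hα0 h1
    linarith

end Central

end Bounds

/-! ### One pass of the interior point method -/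

section Step

variable {m n w : ℕ}

theorem resNorm_of_smul (L : LinProg m n) {z z₀ : Point m n} {η : ℝ} (hη : 0 ≤ η)
    (hp : L.primalRes z = η • L.primalRes z₀) (hd : L.dualRes z = η • L.dualRes z₀) :
    L.resNorm z = η * L.resNorm z₀ := by
  unfold LinProg.resNorm
  rw [hp, hd]
  simp only [Pi.smul_apply, smul_eq_mul, mul_pow, ← Finset.mul_sum, ← mul_add]
  rw [Real.sqrt_mul (sq_nonneg η), Real.sqrt_sq hη]

theorem primalRes_add_smul (L : LinProg m n) {z d : Point m n} (α : ℝ)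
    (hd : L.A *ᵥ d.x = -L.primalRes z) :
    L.primalRes (z + α • d) = (1 - α) • L.primalRes z := by
  have : L.primalRes (z + α • d) = L.primalRes z + α • (L.A *ᵥ d.x) := by
    change L.A *ᵥ (z.x + α • d.x) - L.b = (L.A *ᵥ z.x - L.b) + _
    rw [mulVec_add, mulVec_smul]
    abel
  rw [this, hd]
  module

theorem dualRes_add_smul (L : LinProg m n) {z d : Point m n} (α : ℝ)
    (hd : L.Aᵀ *ᵥ d.y + d.s = -L.dualRes z) :
    L.dualRes (z + α • d) = (1 - α) • L.dualRes z := by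
  have : L.dualRes (z + α • d) = L.dualRes z + α • (L.Aᵀ *ᵥ d.y + d.s) := by
    change L.Aᵀ *ᵥ (z.y + α • d.y) + (z.s + α • d.s) - L.c = (L.Aᵀ *ᵥ z.y + z.s - L.c) + _
    rw [mulVec_add, mulVec_smul, smul_add]
    abel
  rw [this, hd]
  module

/-- The initial point dominates an optimal solution and the dual slack. -/
structure GoodStart (L : LinProg m n) (z₀ zs : Point m n) : Prop where
  opt : zs ∈ L.optimalSet
  x_le : ∀ i, zs.x i ≤ z₀.x i
  s_le : ∀ i, zs.s i ≤ z₀.s i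
  slack : ∀ i, |L.c i - (L.Aᵀ *ᵥ z₀.y) i| ≤ z₀.s i

namespace GoodStart

variable {L : LinProg m n} {z₀ zs z : Point m n} {η : ℝ}

theorem primalRes_eq (h : GoodStart L z₀ zs) : L.primalRes z₀ = L.A *ᵥ (z₀.x - zs.x) := by
  rw [LinProg.primalRes, mulVec_sub, h.opt.1.1.1]

theorem dualRes_eq (h : GoodStart L z₀ zs) :
    L.dualRes z₀ = L.Aᵀ *ᵥ (z₀.y - zs.y) + (z₀.s - zs.s) := by
  rw [LinProg.dualRes, mulVec_sub, ← h.opt.2.1.1]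
  abel

theorem x_nonneg (h : GoodStart L z₀ zs) (i : Fin n) : 0 ≤ z₀.x i :=
  (h.opt.1.1.2 i).trans (h.x_le i)

theorem s_nonneg (h : GoodStart L z₀ zs) (i : Fin n) : 0 ≤ z₀.s i :=
  (h.opt.2.1.2 i).trans (h.s_le i)

/-- The slack condition is needed because `p` contains the full dual residual, including `Aᵀ(y⁰ -
y*)`, which `s⁰ - s*` alone does not control. -/
theorem abs_dualRes_le (h : GoodStart L z₀ zs) (i : Fin n) : |L.dualRes z₀ i| ≤ 2 * z₀.s i := by
  have h1 := abs_le.mp (h.slack i)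
  have h2 := h.s_nonneg i
  have h3 : L.dualRes z₀ i = (L.Aᵀ *ᵥ z₀.y) i + z₀.s i - L.c i := rfl
  rw [h3, abs_le]
  constructor <;> linarith [h1.1, h1.2]

/-- A displacement which cancels the residual is orthogonal to its dual counterpart after a
correction by the distance to the optimal solution. -/
theorem orthogonal (h : GoodStart L z₀ zs) {dx ds : Fin n → ℝ} {dy : Fin m → ℝ}
    (hp : L.A *ᵥ dx = -(η • L.primalRes z₀)) (hd : L.Aᵀ *ᵥ dy + ds = -(η • L.dualRes z₀)) :
    (dx + η • (z₀.x - zs.x)) ⬝ᵥ (ds + η • (z₀.s - zs.s)) = 0 := by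
  have h1 : L.A *ᵥ (dx + η • (z₀.x - zs.x)) = 0 := by
    rw [mulVec_add, mulVec_smul, ← h.primalRes_eq, hp]
    simp
  have h2 : ds + η • (z₀.s - zs.s) = -(L.Aᵀ *ᵥ (dy + η • (z₀.y - zs.y))) := by
    have h3 : ds = -(η • L.dualRes z₀) - L.Aᵀ *ᵥ dy := by rw [← hd]; abel
    rw [h3, h.dualRes_eq, mulVec_add, mulVec_smul, smul_add]
    abel
  rw [h2, dotProduct_neg, dotProduct_mulVec_comm, transpose_transpose, h1, zero_dotProduct,
    neg_zero]

/-- `orthogonal` is applied to the displacement from `z` to the optimum. Expanding, using `x*ᵀs* =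
0` and dropping nonnegative terms leaves at most `xᵀs + 2η x⁰ᵀs⁰`, and `η x⁰ᵀs⁰ ≤ xᵀs`. -/
theorem infeasibility_bound (h : GoodStart L z₀ zs) (hη0 : 0 ≤ η) (hη1 : η ≤ 1)
    (hx : ∀ i, 0 ≤ z.x i) (hs : ∀ i, 0 ≤ z.s i)
    (hp : L.primalRes z = η • L.primalRes z₀) (hd : L.dualRes z = η • L.dualRes z₀)
    (hμ : η * (z₀.x ⬝ᵥ z₀.s) ≤ z.x ⬝ᵥ z.s) :
    η * (z.s ⬝ᵥ z₀.x + z.x ⬝ᵥ z₀.s) ≤ 3 * (z.x ⬝ᵥ z.s) := by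
  have hp' : L.A *ᵥ (zs.x - z.x) = -(η • L.primalRes z₀) := by
    rw [← hp, mulVec_sub, h.opt.1.1.1, LinProg.primalRes]
    abel
  have hd' : L.Aᵀ *ᵥ (zs.y - z.y) + (zs.s - z.s) = -(η • L.dualRes z₀) := by
    rw [← hd, mulVec_sub, LinProg.dualRes, ← h.opt.2.1.1]
    abel
  have horth := h.orthogonal hp' hd'
  have hcs := optimal_complementary L h.opt
  have hnn : ∀ {u v : Fin n → ℝ}, (∀ i, 0 ≤ u i) → (∀ i, 0 ≤ v i) → 0 ≤ u ⬝ᵥ v :=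
    fun hu hv => Finset.sum_nonneg fun i _ => mul_nonneg (hu i) (hv i)
  have hmono : ∀ {u v u' v' : Fin n → ℝ}, (∀ i, 0 ≤ u i) → (∀ i, 0 ≤ v' i) → (∀ i, u i ≤ u' i) →
      (∀ i, v i ≤ v' i) → u ⬝ᵥ v ≤ u' ⬝ᵥ v' := fun hu hv hle hle' =>
    Finset.sum_le_sum fun i _ => (mul_le_mul_of_nonneg_left (hle' i) (hu i)).trans
      (mul_le_mul_of_nonneg_right (hle i) (hv i))
  have hxs : z.s ⬝ᵥ zs.x = zs.x ⬝ᵥ z.s := dotProduct_comm _ _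
  have h1 := hnn (h.opt.1.1.2) hs
  have h2 := hnn hx (h.opt.2.1.2)
  have h3 : zs.x ⬝ᵥ z₀.s ≤ z₀.x ⬝ᵥ z₀.s :=
    hmono h.opt.1.1.2 h.s_nonneg h.x_le fun i => le_rfl
  have h4 : z₀.x ⬝ᵥ zs.s ≤ z₀.x ⬝ᵥ z₀.s :=
    hmono h.x_nonneg h.s_nonneg (fun i => le_rfl) h.s_le
  have h5 := hnn h.x_nonneg h.s_nonneg
  simp only [add_dotProduct, dotProduct_add, sub_dotProduct, dotProduct_sub, smul_dotProduct,
    dotProduct_smul, smul_eq_mul, hcs] at horth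
  rw [dotProduct_comm z.s]
  have hη' : 0 ≤ 1 - η := by linarith
  have h6 : η * (1 - η) * (zs.x ⬝ᵥ z₀.s) ≤ η * (1 - η) * (z₀.x ⬝ᵥ z₀.s) :=
    mul_le_mul_of_nonneg_left h3 (mul_nonneg hη0 hη')
  have h7 : η * (1 - η) * (z₀.x ⬝ᵥ zs.s) ≤ η * (1 - η) * (z₀.x ⬝ᵥ z₀.s) :=
    mul_le_mul_of_nonneg_left h4 (mul_nonneg hη0 hη')
  have h8 : 0 ≤ (1 - η) * (zs.x ⬝ᵥ z.s) := mul_nonneg hη' h1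
  have h9 : 0 ≤ (1 - η) * (z.x ⬝ᵥ zs.s) := mul_nonneg hη' h2
  have h10 : 0 ≤ η ^ 2 * (z₀.x ⬝ᵥ z₀.s) := mul_nonneg (sq_nonneg _) h5
  linarith

end GoodStart

/-! ### The normal equations and the search direction. -/

theorem scaledMatrix_transpose_injective {L : LinProg m n} (hL : ∀ y, L.Aᵀ *ᵥ y = 0 → y = 0)
    {z : Point m n} (hx : ∀ i, 0 < z.x i) (hs : ∀ i, 0 < z.s i) (y : Fin m → ℝ)
    (hy : (scaledMatrix L z)ᵀ *ᵥ y = 0) : y = 0 := by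
  refine hL y ?_
  rw [scaledMatrix, transpose_mul, diagonal_transpose, ← mulVec_mulVec] at hy
  ext i
  have := congrFun hy i
  rw [mulVec_diagonal, Pi.zero_apply] at this
  exact (mul_eq_zero.mp this).resolve_left (Real.sqrt_pos.mpr (div_pos (hx i) (hs i))).ne'

theorem scaledMatrix_mulVec (L : LinProg m n) (z : Point m n) (u : Fin n → ℝ) :
    scaledMatrix L z *ᵥ u = L.A *ᵥ fun i => Real.sqrt (z.x i / z.s i) * u i := by
  rw [scaledMatrix, ← mulVec_mulVec]
  congr 1
  ext i
  rw [mulVec_diagonal]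

theorem scaledMatrix_gram_mulVec (L : LinProg m n) {z : Point m n} (hx : ∀ i, 0 < z.x i)
    (hs : ∀ i, 0 < z.s i) (y : Fin m → ℝ) :
    (scaledMatrix L z * (scaledMatrix L z)ᵀ) *ᵥ y =
      L.A *ᵥ fun i => z.x i / z.s i * (L.Aᵀ *ᵥ y) i := by
  rw [← mulVec_mulVec, scaledMatrix_mulVec]
  congr 1
  ext i
  rw [scaledMatrix, transpose_mul, diagonal_transpose, ← mulVec_mulVec, mulVec_diagonal,
    ← mul_assoc, Real.mul_self_sqrt (div_pos (hx i) (hs i)).le]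

/-- The right-hand side of the normal equations lies in the range of the scaled matrix, with a
preimage of controlled norm. -/
theorem exists_rhs_preimage {L : LinProg m n} {z₀ zs z : Point m n} {η σ Λ : ℝ}
    (h : GoodStart L z₀ zs) (hc : Central Λ (dualityMeasure z) z.x z.s)
    (hη0 : 0 ≤ η) (hσ0 : 0 ≤ σ) (hσ1 : σ ≤ 1)
    (hp : L.primalRes z = η • L.primalRes z₀) (hd : L.dualRes z = η • L.dualRes z₀)
    (hinf : η * (z.s ⬝ᵥ z₀.x + z.x ⬝ᵥ z₀.s) ≤ 3 * (z.x ⬝ᵥ z.s)) :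
    ∃ g, rhs L σ z = scaledMatrix L z *ᵥ g ∧
      l2 g ≤ 8 * n * (Real.sqrt (Λ / dualityMeasure z) * dualityMeasure z) := by
  set μ := dualityMeasure z with hμ
  set e : Fin n → ℝ := fun i => Real.sqrt (z.x i * z.s i) with he
  have he0 : ∀ i, 0 < e i := hc.sqrt_pos
  have hee : ∀ i, e i * e i = z.x i * z.s i := hc.mul_self_sqrt
  -- Since `r_p = η A (x⁰ - x*)`, the primal residual also lies in the range of `A D`, with a
  -- preimage bounded through `P`. The dual part is `R`.
  set P : Fin n → ℝ := fun i => z.s i * (η * (z₀.x i - zs.x i)) with hP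
  set R : Fin n → ℝ := fun i => z.x i * (η * L.dualRes z₀ i) with hR
  have hsx : 0 ≤ z.s ⬝ᵥ z₀.x :=
    Finset.sum_nonneg fun i _ => mul_nonneg (hc.s_pos i).le (h.x_nonneg i)
  have hPs : ∑ i, |P i| ≤ η * (z.s ⬝ᵥ z₀.x) := by
    simp only [dotProduct, Finset.mul_sum]
    refine Finset.sum_le_sum fun i _ => ?_
    have h1 : |z₀.x i - zs.x i| ≤ z₀.x i := by
      rw [abs_of_nonneg (sub_nonneg.mpr (h.x_le i))]
      linarith [h.opt.1.1.2 i]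
    rw [hP, abs_mul, abs_mul, abs_of_pos (hc.s_pos i), abs_of_nonneg hη0]
    calc _ ≤ z.s i * (η * z₀.x i) := by
          have := (hc.s_pos i).le
          gcongr
      _ = _ := by ring
  have hRs : ∑ i, |R i| ≤ 2 * (η * (z.x ⬝ᵥ z₀.s)) := by
    simp only [dotProduct, Finset.mul_sum]
    refine Finset.sum_le_sum fun i _ => ?_
    rw [hR, abs_mul, abs_mul, abs_of_pos (hc.x_pos i), abs_of_nonneg hη0]
    calc _ ≤ z.x i * (η * (2 * z₀.s i)) := by
          have := (hc.x_pos i).le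
          have := h.abs_dualRes_le i
          gcongr
      _ = _ := by ring
  refine ⟨(e - fun i => σ * μ / e i) - ((fun i => P i / e i) + fun i => R i / e i), ?_, ?_⟩
  · have hD : ∀ i, Real.sqrt (z.x i / z.s i) = z.x i / e i := fun i => by
      rw [eq_div_iff (he0 i).ne', he, ← Real.sqrt_mul (div_pos (hc.x_pos i) (hc.s_pos i)).le]
      have : z.x i / z.s i * (z.x i * z.s i) = z.x i * z.x i := by
        have := (hc.s_pos i).ne'
        field_simp
      rw [this, Real.sqrt_mul_self (hc.x_pos i).le]
    have hfun : (fun i => Real.sqrt (z.x i / z.s i) *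
        ((e - fun i => σ * μ / e i) - ((fun i => P i / e i) + fun i => R i / e i)) i) =
        -(η • (z₀.x - zs.x)) - (σ * μ) • (fun i => (z.s i)⁻¹) + z.x
          - fun i => z.x i / z.s i * L.dualRes z i := by
      ext i
      have h1 := (he0 i).ne'
      have h2 := (hc.x_pos i).ne'
      have h3 := (hc.s_pos i).ne'
      rw [hD, hd]
      simp only [Pi.add_apply, Pi.sub_apply, Pi.neg_apply, Pi.smul_apply, smul_eq_mul, hP, hR]
      calc _ = z.x i - z.x i / (e i * e i) * (σ * μ + z.s i * (η * (z₀.x i - zs.x i))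
                + z.x i * (η * L.dualRes z₀ i)) := by field_simp; ring
        _ = _ := by rw [hee]; field_simp; ring
    rw [scaledMatrix_mulVec, hfun, rhs, hp, h.primalRes_eq, mulVec_sub L.A (_ + _), mulVec_add,
      mulVec_sub L.A (-_), mulVec_neg, mulVec_smul, mulVec_smul]
  · have h1 : l2 e ≤ _ := hc.l2_sqrt_le
    have h2 : l2 (fun i => σ * μ / e i) ≤ _ := hc.l2_mu_div_le hσ0 hσ1
    have h3 : l2 (fun i => P i / e i) ≤ _ := hc.l2_sum_div_le hPs
    have h4 : l2 (fun i => R i / e i) ≤ _ := hc.l2_sum_div_le hRs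
    have h5 := l2_sub_le (e - fun i => σ * μ / e i) ((fun i => P i / e i) + fun i => R i / e i)
    have h6 := l2_sub_le e (fun i => σ * μ / e i)
    have h7 := l2_add_le (fun i => P i / e i) (fun i => R i / e i)
    -- Six units come from the infeasible part; `e` and the centring term add one each, hence `8`.
    have h8 : η * (z.s ⬝ᵥ z₀.x) + 2 * (η * (z.x ⬝ᵥ z₀.s)) ≤ 6 * (n * μ) := by
      rw [hc.sum_eq] at hinf
      have := mul_nonneg hη0 hsx
      linarith
    have h9 := mul_le_mul_of_nonneg_left h8 (Real.sqrt_nonneg (Λ / μ))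
    linarith

theorem card_mul_dualityMeasure (hn : 0 < n) (z : Point m n) :
    n * dualityMeasure z = z.x ⬝ᵥ z.s := by
  rw [dualityMeasure]
  have : (n : ℝ) ≠ 0 := by exact_mod_cast hn.ne'
  field_simp

/-- With a good sketch and enough solver steps, the search direction cancels the residual, and
every short step along it stays in the neighbourhood and decreases the duality measure. -/
theorem direction_short_step {L : LinProg m n} {z₀ zs z : Point m n} {η σ γ Λ : ℝ} (hn : 0 < n)
    (hL : ∀ y, L.Aᵀ *ᵥ y = 0 → y = 0) (h : GoodStart L z₀ zs)
    (hΛ : 1 ≤ Λ) (hγ : 0 < γ) (hγ1 : γ < 1) (hσ : 0 < σ) (hσ1 : σ < 4 / 5) (hγΛ : 1 ≤ Λ * γ)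
    (hγΛ' : 1 ≤ Λ * (1 - γ)) (hσΛ : 1 ≤ Λ * σ)
    (hx : ∀ i, 0 < z.x i) (hs : ∀ i, 0 < z.s i)
    (hcen : ∀ i, (1 - γ) * dualityMeasure z ≤ z.x i * z.s i) (hη0 : 0 ≤ η) (hη1 : η ≤ 1)
    (hp : L.primalRes z = η • L.primalRes z₀) (hd : L.dualRes z = η • L.dualRes z₀)
    (hημ : η * dualityMeasure z₀ ≤ dualityMeasure z)
    {W : Matrix (Fin n) (Fin w) ℝ} (hW : SketchGood (scaledMatrix L z) W)
    {B : Matrix (Fin w) (Fin m) ℝ} (hB : IsPinv (scaledMatrix L z * W) B) (sv : Solver) {t : ℕ}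
    (ht : 1024 * n ^ 2 * Λ ^ 3 * (2 / 3 : ℝ) ^ t ≤ 1) {d : Point m n}
    (hdir : d = direction L σ z (dirY L σ (1 / 2) sv t W z)
      (correction L σ W B z (dirY L σ (1 / 2) sv t W z))) :
    L.A *ᵥ d.x = -L.primalRes z ∧ L.Aᵀ *ᵥ d.y + d.s = -L.dualRes z ∧
      ∀ α, 0 ≤ α → α * (2000 * Λ ^ 3 * n ^ 2) ≤ 1 → z + α • d ∈ neighborhood L γ z₀ ∧
        dualityMeasure (z + α • d) ≤ (1 - α / 20) * dualityMeasure z := by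
  set μ := dualityMeasure z with hμ
  have hnμ : n * μ = z.x ⬝ᵥ z.s := card_mul_dualityMeasure hn z
  have hn0 : (0 : ℝ) < n := by exact_mod_cast hn
  have hμ0 : 0 < μ := by
    have : 0 < z.x ⬝ᵥ z.s :=
      Finset.sum_pos (fun i _ => mul_pos (hx i) (hs i)) ⟨⟨0, hn⟩, Finset.mem_univ _⟩
    rw [← hnμ] at this
    exact pos_of_mul_pos_right this hn0.le
  have hΛ0 : 0 < Λ := zero_lt_one.trans_le hΛ
  have hc : Central Λ μ z.x z.s := ⟨hn, hΛ, hμ0, hx, hs, hnμ.symm, fun i => by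
    calc μ ≤ Λ * (1 - γ) * μ := le_mul_of_one_le_left hμ0.le hγΛ'
      _ = Λ * ((1 - γ) * μ) := by ring
      _ ≤ _ := mul_le_mul_of_nonneg_left (hcen i) hΛ0.le⟩
  have hn1 := hc.one_le_card
  have hinf := h.infeasibility_bound hη0 hη1 (fun i => (hx i).le) (fun i => (hs i).le) hp hd (by
    rw [← hnμ, ← card_mul_dualityMeasure hn z₀]
    calc _ = n * (η * dualityMeasure z₀) := by ring
      _ ≤ _ := mul_le_mul_of_nonneg_left hημ hn0.le)
  obtain ⟨g, hg, hgl⟩ := exists_rhs_preimage h hc hη0 hσ.le (by linarith) hp hd hinf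
  set F := scaledMatrix L z with hF
  set dy := dirY L σ (1 / 2) sv t W z with hdy
  set f := (F * Fᵀ) *ᵥ dy - rhs L σ z with hf
  set v := correction L σ W B z dy with hv
  set q := W *ᵥ (B *ᵥ f) with hq
  have hvq : ∀ i, v i = Real.sqrt (z.x i * z.s i) * q i := fun i => rfl
  obtain ⟨hFq, hql⟩ := correction_bound (scaledMatrix_transpose_injective hL hx hs) hW hB sv t g f
    (by rw [← hg]; rfl)
  -- the correction vector is small
  have hvl : l2 v ≤ μ / (16 * Λ ^ 2) := by
    have h1 : l2 v ≤ Real.sqrt (n * μ) * l2 q := by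
      rw [← abs_of_nonneg (Real.sqrt_nonneg (n * μ)), ← l2_smul]
      refine l2_le_of_sq_le (l2_nonneg _) ?_
      rw [l2_sq]
      refine Finset.sum_le_sum fun i _ => ?_
      rw [hvq, Pi.smul_apply, smul_eq_mul]
      have h2 : z.x i * z.s i ≤ n * μ := by
        rw [hnμ]
        exact Finset.single_le_sum (f := fun i => z.x i * z.s i)
          (fun j _ => (mul_pos (hx j) (hs j)).le) (Finset.mem_univ i)
      calc _ = z.x i * z.s i * (q i * q i) := by
            rw [mul_mul_mul_comm, hc.mul_self_sqrt]
        _ ≤ n * μ * (q i * q i) := mul_le_mul_of_nonneg_right h2 (mul_self_nonneg _)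
        _ = _ := by
            rw [mul_mul_mul_comm (Real.sqrt _), Real.mul_self_sqrt (by positivity)]
    have hpw : 0 ≤ (2 / 3 : ℝ) ^ t := by positivity
    -- The left side is `n √(2Λ)`. The final constant is `1024 = 2 · 4 · 8 · 16`.
    have h3 : Real.sqrt (n * μ) * Real.sqrt (2 * n) * Real.sqrt (Λ / μ) ≤ 2 * n * Λ := by
      rw [← Real.sqrt_mul (by positivity), ← Real.sqrt_mul (by positivity)]
      refine Real.sqrt_le_iff.mpr ⟨by positivity, ?_⟩
      have h4 : n * μ * (2 * n) * (Λ / μ) = 2 * (n ^ 2 * Λ) := by field_simp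
      have h5 : Λ ≤ Λ ^ 2 := le_self_pow₀ hΛ two_ne_zero
      have h6 : (n : ℝ) ^ 2 * Λ ≤ n ^ 2 * Λ ^ 2 := mul_le_mul_of_nonneg_left h5 (by positivity)
      have h7 : (0 : ℝ) ≤ n ^ 2 * Λ ^ 2 := by positivity
      rw [h4]
      calc _ ≤ 2 * ((n : ℝ) ^ 2 * Λ ^ 2) + 2 * ((n : ℝ) ^ 2 * Λ ^ 2) := by linarith
        _ = _ := by ring
    rw [le_div_iff₀ (by positivity)]
    calc l2 v * (16 * Λ ^ 2) ≤ (Real.sqrt (n * μ) * (Real.sqrt (2 * n) * (4 * (2 / 3) ^ t *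
          (8 * n * (Real.sqrt (Λ / μ) * μ))))) * (16 * Λ ^ 2) := by
          refine mul_le_mul_of_nonneg_right (h1.trans (mul_le_mul_of_nonneg_left (hql.trans ?_)
            (Real.sqrt_nonneg _))) (by positivity)
          gcongr
      _ = (Real.sqrt (n * μ) * Real.sqrt (2 * n) * Real.sqrt (Λ / μ)) *
            (512 * n * Λ ^ 2 * (2 / 3) ^ t * μ) := by ring
      _ ≤ 2 * n * Λ * (512 * n * Λ ^ 2 * (2 / 3) ^ t * μ) :=
          mul_le_mul_of_nonneg_right h3 (by positivity)
      _ = 1024 * n ^ 2 * Λ ^ 3 * (2 / 3) ^ t * μ := by ring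
      _ ≤ 1 * μ := mul_le_mul_of_nonneg_right ht hμ0.le
      _ = μ := one_mul μ
  have hdx : ∀ i, d.x i = -z.x i + σ * μ * (z.s i)⁻¹ - z.x i / z.s i * d.s i
      - (z.s i)⁻¹ * v i := fun i => by rw [hdir]; rfl
  have hds : d.s = -L.dualRes z - L.Aᵀ *ᵥ dy := by rw [hdir]; rfl
  have hdy' : d.y = dy := by rw [hdir]; rfl
  have hdual : L.Aᵀ *ᵥ d.y + d.s = -L.dualRes z := by
    rw [hds, hdy']
    abel
  have hprimal : L.A *ᵥ d.x = -L.primalRes z := by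
    -- Here `S⁻¹ v = D q`, and `A D q = f` cancels exactly the defect of `Δy` in the normal
    -- equations.
    have h1 : d.x = -z.x + (σ * μ) • (fun i => (z.s i)⁻¹) + (fun i => z.x i / z.s i * L.dualRes z i)
        + (fun i => z.x i / z.s i * (L.Aᵀ *ᵥ dy) i)
        - fun i => Real.sqrt (z.x i / z.s i) * q i := by
      ext i
      have h2 : (z.s i)⁻¹ * Real.sqrt (z.x i * z.s i) = Real.sqrt (z.x i / z.s i) := by
        have h3 : z.x i / z.s i = z.x i * z.s i / (z.s i * z.s i) := by
          have := (hs i).ne'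
          field_simp
        rw [h3, Real.sqrt_div (mul_pos (hx i) (hs i)).le, Real.sqrt_mul_self (hs i).le]
        ring
      rw [hdx, hds, hvq, ← mul_assoc, h2]
      simp only [Pi.add_apply, Pi.sub_apply, Pi.neg_apply, Pi.smul_apply, smul_eq_mul]
      ring
    rw [h1, mulVec_sub, ← scaledMatrix_mulVec, ← hF, hFq, mulVec_add, mulVec_add, mulVec_add,
      ← scaledMatrix_gram_mulVec L hx hs, hf, rhs, mulVec_neg, mulVec_smul]
    abel
  refine ⟨hprimal, hdual, fun α hα0 hα => ?_⟩
  have heq : ∀ i, z.s i * d.x i + z.x i * d.s i = -(z.x i * z.s i) + σ * μ - v i := fun i => by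
    have := (hs i).ne'
    rw [hdx]
    field_simp
    ring
  have hv1 : l2 v ≤ μ := hvl.trans (div_le_self hμ0.le (by nlinarith [one_le_pow₀ hΛ (n := 2)]))
  have horth := h.orthogonal (hprimal.trans (by rw [hp])) (hdual.trans (by rw [hd]))
  have hpq : z.s ⬝ᵥ (η • (z₀.x - zs.x)) + z.x ⬝ᵥ (η • (z₀.s - zs.s)) ≤ 3 * n * μ := by
    have h1 : 0 ≤ z.s ⬝ᵥ zs.x :=
      Finset.sum_nonneg fun i _ => mul_nonneg (hs i).le (h.opt.1.1.2 i)
    have h2 : 0 ≤ z.x ⬝ᵥ zs.s :=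
      Finset.sum_nonneg fun i _ => mul_nonneg (hx i).le (h.opt.2.1.2 i)
    have h3 := mul_nonneg hη0 h1
    have h4 := mul_nonneg hη0 h2
    simp only [dotProduct_smul, dotProduct_sub, smul_eq_mul]
    linarith
  obtain ⟨hb1, hb2⟩ := hc.scaled_direction_bounds hσ.le (by linarith)
    (fun i => mul_nonneg hη0 (sub_nonneg.mpr (h.x_le i)))
    (fun i => mul_nonneg hη0 (sub_nonneg.mpr (h.s_le i))) hpq hv1 heq horth
  obtain ⟨hb3, hb4, hb5, hb6⟩ := hc.direction_bounds hb1 hb2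
  obtain ⟨hc1, hc2, hc3, hc4, hc5⟩ := hc.short_step hγ hγ1 hσ hσ1 hγΛ hσΛ hcen hvl heq hb3 hb4 hb5
    hb6 hα0 hα
  have hα1 : α ≤ 1 := by
    have h1 : (1 : ℝ) ≤ Λ ^ 3 * n ^ 2 :=
      one_le_mul_of_one_le_of_one_le (one_le_pow₀ hΛ) (one_le_pow₀ hn1)
    exact (le_mul_of_one_le_right hα0 (by linarith)).trans hα
  refine ⟨⟨hc1, hc2, hc3, ?_⟩, hc5⟩
  rw [resNorm_of_smul L (z := z + α • d) (z₀ := z₀) (η := (1 - α) * η)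
    (mul_nonneg (by linarith) hη0) (by rw [primalRes_add_smul L α hprimal, hp, smul_smul])
    (by rw [dualRes_add_smul L α hdual, hd, smul_smul])]
  -- The residual shrinks by exactly `1 - α` and the duality measure by no more than that, so the
  -- ratio condition persists.
  have h1 : (1 - α) * (η * dualityMeasure z₀) ≤ dualityMeasure (z + α • d) :=
    (mul_le_mul_of_nonneg_left hημ (by linarith)).trans hc4
  calc _ = (1 - α) * (η * dualityMeasure z₀) * L.resNorm z₀ := by ring
    _ ≤ _ := mul_le_mul_of_nonneg_right h1 (Real.sqrt_nonneg _)

end Step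

/-! ### The line search and the whole run -/

section Run

variable {m n w : ℕ}

theorem continuous_point_x : Continuous (Point.x : Point m n → Fin n → ℝ) := continuous_fst

theorem continuous_point_y : Continuous (Point.y : Point m n → Fin m → ℝ) :=
  continuous_fst.comp continuous_snd

theorem continuous_point_s : Continuous (Point.s : Point m n → Fin n → ℝ) :=
  continuous_snd.comp continuous_snd

theorem continuous_dualityMeasure : Continuous (dualityMeasure : Point m n → ℝ) :=
  (continuous_point_x.dotProduct continuous_point_s).div_const _

theorem continuous_resNorm (L : LinProg m n) : Continuous L.resNorm := by
  have h1 : Continuous L.primalRes :=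
    (continuous_const.matrix_mulVec continuous_point_x).sub continuous_const
  have h2 : Continuous L.dualRes :=
    ((continuous_const.matrix_mulVec continuous_point_y).add continuous_point_s).sub
      continuous_const
  refine Real.continuous_sqrt.comp (Continuous.add ?_ ?_)
  · exact continuous_finsetSum _ fun i _ => ((continuous_apply i).comp h1).pow 2
  · exact continuous_finsetSum _ fun i _ => ((continuous_apply i).comp h2).pow 2

/-- The neighbourhood with weak positivity. -/
def closedNeighborhood (L : LinProg m n) (γ : ℝ) (z₀ : Point m n) : Set (Point m n) :=
  {z | (∀ i, 0 ≤ z.x i) ∧ (∀ i, 0 ≤ z.s i) ∧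
    (∀ i, (1 - γ) * dualityMeasure z ≤ z.x i * z.s i) ∧
    L.resNorm z * dualityMeasure z₀ ≤ dualityMeasure z * L.resNorm z₀}

theorem neighborhood_subset_closedNeighborhood (L : LinProg m n) (γ : ℝ) (z₀ : Point m n) :
    neighborhood L γ z₀ ⊆ closedNeighborhood L γ z₀ :=
  fun _ h => ⟨fun i => (h.1 i).le, fun i => (h.2.1 i).le, h.2.2⟩

theorem isClosed_closedNeighborhood (L : LinProg m n) (γ : ℝ) (z₀ : Point m n) :
    IsClosed (closedNeighborhood L γ z₀) := by
  have hx : ∀ i, Continuous fun z : Point m n => z.x i := fun i =>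
    (continuous_apply i).comp continuous_point_x
  have hs : ∀ i, Continuous fun z : Point m n => z.s i := fun i =>
    (continuous_apply i).comp continuous_point_s
  simp only [closedNeighborhood, Set.ofPred_and, Set.ofPred_forall]
  refine (isClosed_iInter fun i => isClosed_le continuous_const (hx i)).inter
    ((isClosed_iInter fun i => isClosed_le continuous_const (hs i)).inter
    ((isClosed_iInter fun i => isClosed_le (continuous_const.mul continuous_dualityMeasure)
      ((hx i).mul (hs i))).inter ?_))
  exact isClosed_le ((continuous_resNorm L).mul continuous_const)
    (continuous_dualityMeasure.mul continuous_const)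

/-- The supremum of admissible steps need not be admissible, so membership is only kept in the
closure. Strict positivity is recovered by `Controlled.pos` as long as `μ > 0`. -/
theorem IsLineSearch.mem_closedNeighborhood {L : LinProg m n} {γ : ℝ} {z₀ z d z' : Point m n}
    (h : IsLineSearch L γ z₀ z d z') (hz : z ∈ neighborhood L γ z₀) :
    ∃ α ∈ Set.Icc (0 : ℝ) 1, z' = z + α • d ∧ z' ∈ closedNeighborhood L γ z₀ := by
  obtain ⟨α₁, α₂, hlub, hα, -, rfl⟩ := h
  have hα₁ : α₁ ≤ 1 := hlub.2 fun α hα => hα.1.2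
  refine ⟨α₂, ⟨hα.1, hα.2.trans hα₁⟩, rfl, ?_⟩
  set S := {α : ℝ | α ∈ Set.Icc (0 : ℝ) 1 ∧
      ∀ α' ∈ Set.Icc (0 : ℝ) α, z + α' • d ∈ neighborhood L γ z₀} with hS
  have hcont : Continuous fun α : ℝ => z + α • d :=
    continuous_const.add (continuous_id.smul continuous_const)
  have hsub : S ⊆ (fun α : ℝ => z + α • d) ⁻¹' closedNeighborhood L γ z₀ := fun α hα =>
    neighborhood_subset_closedNeighborhood L γ z₀ (hα.2 α ⟨hα.1.1, le_rfl⟩)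
  rcases hα.2.eq_or_lt with heq | hlt
  · have hne : S.Nonempty := by
      refine ⟨0, ⟨le_rfl, zero_le_one⟩, fun α' hα' => ?_⟩
      have : α' = 0 := le_antisymm hα'.2 hα'.1
      rwa [this, zero_smul, add_zero]
    have := closure_minimal hsub ((isClosed_closedNeighborhood L γ z₀).preimage hcont)
      (hlub.mem_closure hne)
    rwa [heq]
  · obtain ⟨β, hβ, hlt'⟩ := (lt_isLUB_iff hlub).mp hlt
    exact neighborhood_subset_closedNeighborhood L γ z₀ (hβ.2 α₂ ⟨hα.1, hlt'.le⟩)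

theorem IsLineSearch.dualityMeasure_le {L : LinProg m n} {γ α : ℝ} {z₀ z d z' : Point m n}
    (h : IsLineSearch L γ z₀ z d z') (hα0 : 0 ≤ α) (hα1 : α ≤ 1)
    (hα : ∀ α' ∈ Set.Icc (0 : ℝ) α, z + α' • d ∈ neighborhood L γ z₀) :
    dualityMeasure z' ≤ dualityMeasure (z + α • d) := by
  obtain ⟨α₁, α₂, hlub, -, hmin, rfl⟩ := h
  exact div_le_div_of_nonneg_right (hmin α ⟨hα0, hlub.1 ⟨⟨hα0, hα1⟩, hα⟩⟩) (Nat.cast_nonneg n)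

/-- The invariant of the run: the iterate lies in the closed neighbourhood, and its residual is a
multiple of the initial residual. -/
structure Controlled (L : LinProg m n) (γ : ℝ) (z₀ z : Point m n) : Prop where
  mem : z ∈ closedNeighborhood L γ z₀
  res : ∃ η : ℝ, 0 ≤ η ∧ η ≤ 1 ∧ η * dualityMeasure z₀ ≤ dualityMeasure z ∧
    L.primalRes z = η • L.primalRes z₀ ∧ L.dualRes z = η • L.dualRes z₀

theorem residuals_eq_zero {L : LinProg m n} {z : Point m n} (h : L.resNorm z = 0) :
    L.primalRes z = 0 ∧ L.dualRes z = 0 := by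
  have h1 : 0 ≤ ∑ i, L.primalRes z i ^ 2 := Finset.sum_nonneg fun i _ => sq_nonneg _
  have h2 : 0 ≤ ∑ j, L.dualRes z j ^ 2 := Finset.sum_nonneg fun i _ => sq_nonneg _
  rw [LinProg.resNorm, Real.sqrt_eq_zero (add_nonneg h1 h2)] at h
  have h3 : ∑ i, L.primalRes z i ^ 2 = 0 := by linarith
  have h4 : ∑ j, L.dualRes z j ^ 2 = 0 := by linarith
  rw [Finset.sum_eq_zero_iff_of_nonneg fun i _ => sq_nonneg _] at h3 h4
  exact ⟨funext fun i => pow_eq_zero_iff two_ne_zero |>.mp (h3 i (Finset.mem_univ i)),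
    funext fun i => pow_eq_zero_iff two_ne_zero |>.mp (h4 i (Finset.mem_univ i))⟩

/-- If `r⁰ ≠ 0`, cancelling `‖r⁰‖` in the neighbourhood condition bounds `η`. If `r⁰ = 0`, the
multiplier is arbitrary and is taken to be `0`. -/
theorem Controlled.of_residuals {L : LinProg m n} {γ η : ℝ} {z₀ z : Point m n}
    (hz : z ∈ closedNeighborhood L γ z₀) (hη0 : 0 ≤ η) (hη1 : η ≤ 1)
    (hp : L.primalRes z = η • L.primalRes z₀) (hd : L.dualRes z = η • L.dualRes z₀) :
    Controlled L γ z₀ z := by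
  refine ⟨hz, ?_⟩
  have hμ : 0 ≤ dualityMeasure z :=
    div_nonneg (Finset.sum_nonneg fun i _ => mul_nonneg (hz.1 i) (hz.2.1 i)) (Nat.cast_nonneg n)
  rcases (Real.sqrt_nonneg _ : 0 ≤ L.resNorm z₀).eq_or_lt with h0 | h0
  · obtain ⟨h1, h2⟩ := residuals_eq_zero h0.symm
    exact ⟨0, le_rfl, zero_le_one, by rwa [zero_mul], by rw [hp, h1]; simp, by rw [hd, h2]; simp⟩
  · refine ⟨η, hη0, hη1, ?_, hp, hd⟩
    have h1 := hz.2.2.2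
    rw [resNorm_of_smul L hη0 hp hd] at h1
    refine le_of_mul_le_mul_right (a := L.resNorm z₀) ?_ h0
    linarith

theorem Controlled.pos {L : LinProg m n} {γ : ℝ} {z₀ z : Point m n} (h : Controlled L γ z₀ z)
    (hγ1 : γ < 1) (hμ : 0 < dualityMeasure z) : (∀ i, 0 < z.x i) ∧ ∀ i, 0 < z.s i := by
  have h1 : ∀ i, 0 < z.x i * z.s i := fun i =>
    (mul_pos (sub_pos.mpr hγ1) hμ).trans_le (h.mem.2.2.1 i)
  exact ⟨fun i => pos_of_mul_pos_left (h1 i) (h.mem.2.1 i),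
    fun i => pos_of_mul_pos_right (h1 i) (h.mem.1 i)⟩

/-- Admissible parameters of the method, with all constants bounded by `Λ`. -/
structure Params (Λ γ σ : ℝ) (n t : ℕ) : Prop where
  one_le : 1 ≤ Λ
  gamma_pos : 0 < γ
  gamma_lt : γ < 1
  sigma_pos : 0 < σ
  sigma_lt : σ < 4 / 5
  gamma : 1 ≤ Λ * γ
  one_sub_gamma : 1 ≤ Λ * (1 - γ)
  sigma : 1 ≤ Λ * σ
  card_pos : 0 < n
  steps : 1024 * n ^ 2 * Λ ^ 3 * (2 / 3 : ℝ) ^ t ≤ 1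

theorem IsStep.progress {L : LinProg m n} {z₀ zs z z' : Point m n} {σ γ Λ τ : ℝ} {t : ℕ}
    {sv : Solver} {W : Matrix (Fin n) (Fin w) ℝ} (hpar : Params Λ γ σ n t)
    (hL : ∀ y, L.Aᵀ *ᵥ y = 0 → y = 0) (h : GoodStart L z₀ zs) (hτ : 0 ≤ τ)
    (hz : Controlled L γ z₀ z) (hstep : IsStep L γ σ (1 / 2) τ sv t z₀ W z z')
    (hW : (∀ i, 0 < z.x i) → (∀ i, 0 < z.s i) → SketchGood (scaledMatrix L z) W) :
    Controlled L γ z₀ z' ∧ (dualityMeasure z ≤ τ → z' = z) ∧ (τ < dualityMeasure z →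
      dualityMeasure z' ≤ (1 - 1 / (40000 * Λ ^ 3 * n ^ 2)) * dualityMeasure z) := by
  rcases le_or_gt (dualityMeasure z) τ with hle | hlt
  · have := hstep.2 hle
    exact ⟨this ▸ hz, fun _ => this, fun h => absurd h (not_lt.mpr hle)⟩
  obtain ⟨hx, hs⟩ := hz.pos hpar.gamma_lt (hτ.trans_lt hlt)
  obtain ⟨η, hη0, hη1, hημ, hp, hd⟩ := hz.res
  obtain ⟨B, hB, hls⟩ := hstep.1 hlt
  obtain ⟨hdp, hdd, hshort⟩ := direction_short_step hpar.card_pos hL h hpar.one_le hpar.gamma_pos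
    hpar.gamma_lt hpar.sigma_pos hpar.sigma_lt hpar.gamma hpar.one_sub_gamma hpar.sigma hx hs
    hz.mem.2.2.1 hη0 hη1 hp hd hημ (hW hx hs) hB sv hpar.steps rfl
  dsimp only at hls
  generalize direction L σ z (dirY L σ (1 / 2) sv t W z)
      (correction L σ W B z (dirY L σ (1 / 2) sv t W z)) = d at *
  -- The short step of length `0` upgrades closed to open membership.
  have hzN : z ∈ neighborhood L γ z₀ := by
    simpa using (hshort 0 le_rfl (by simp)).1
  have hn1 : (1 : ℝ) ≤ n := by exact_mod_cast hpar.card_pos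
  have hK : (1 : ℝ) ≤ 2000 * Λ ^ 3 * n ^ 2 := by
    have : (1 : ℝ) ≤ Λ ^ 3 * n ^ 2 :=
      one_le_mul_of_one_le_of_one_le (one_le_pow₀ hpar.one_le) (one_le_pow₀ hn1)
    linarith
  have hK0 : (0 : ℝ) < 2000 * Λ ^ 3 * n ^ 2 := zero_lt_one.trans_le hK
  refine ⟨?_, fun h => absurd hlt (not_lt.mpr h), fun _ => ?_⟩
  · obtain ⟨α, hα, rfl, hmem⟩ := hls.mem_closedNeighborhood hzN
    refine Controlled.of_residuals (η := (1 - α) * η) hmem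
      (mul_nonneg (by linarith [hα.2]) hη0)
      (mul_le_one₀ (by linarith [hα.1]) hη0 hη1) ?_ ?_
    · rw [primalRes_add_smul L α hdp, hp, smul_smul]
    · rw [dualRes_add_smul L α hdd, hd, smul_smul]
  -- The line search is compared with the longest guaranteed short step; the rate `1/20` turns
  -- `2000` into `40000`.
  · have hα0 : 0 ≤ 1 / (2000 * Λ ^ 3 * (n : ℝ) ^ 2) := one_div_nonneg.mpr hK0.le
    have hα : 1 / (2000 * Λ ^ 3 * (n : ℝ) ^ 2) * (2000 * Λ ^ 3 * n ^ 2) = 1 :=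
      one_div_mul_cancel hK0.ne'
    refine (hls.dualityMeasure_le hα0 ((div_le_one hK0).mpr hK) fun α' hα' => ?_).trans ?_
    · refine (hshort α' hα'.1 ?_).1
      rw [← hα]
      exact mul_le_mul_of_nonneg_right hα'.2 hK0.le
    · refine (hshort _ hα0 hα.le).2.trans_eq ?_
      have : 1 / (2000 * Λ ^ 3 * (n : ℝ) ^ 2) / 20 = 1 / (40000 * Λ ^ 3 * n ^ 2) := by
        rw [div_div]
        congr 1
        ring
      rw [this]

/-- If all sketches used in the first `K` passes are good, the run has converged after `K` passes,
and stays where it is. -/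
theorem run_converges {L : LinProg m n} {z₀ zs : Point m n} {σ γ Λ ε : ℝ} {t K : ℕ}
    {sv : Solver} {W : ℕ → Matrix (Fin n) (Fin w) ℝ} {z : ℕ → Point m n}
    (hpar : Params Λ γ σ n t) (hL : ∀ y, L.Aᵀ *ᵥ y = 0 → y = 0) (h : GoodStart L z₀ zs)
    (hz₀ : z₀ ∈ neighborhood L γ z₀) (hε : 0 < ε) (hinit : z 0 = z₀)
    (hstep : ∀ k, IsStep L γ σ (1 / 2) (ε * dualityMeasure z₀) sv t z₀ (W k) (z k) (z (k + 1)))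
    (hW : ∀ k < K, (∀ i, 0 < (z k).x i) → (∀ i, 0 < (z k).s i) →
      SketchGood (scaledMatrix L (z k)) (W k))
    (hK : 40000 * Λ ^ 3 * n ^ 2 * Real.log (1 / ε) ≤ K) {k : ℕ} (hk : K ≤ k) :
    dualityMeasure (z k) ≤ ε * dualityMeasure z₀ ∧ L.resNorm (z k) ≤ ε * L.resNorm z₀ := by
  have hn0 : (0 : ℝ) < n := by exact_mod_cast hpar.card_pos
  have hn1 : (1 : ℝ) ≤ n := by exact_mod_cast hpar.card_pos
  have hμ₀ : 0 < dualityMeasure z₀ := div_pos (Finset.sum_pos (fun i _ =>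
    mul_pos (hz₀.1 i) (hz₀.2.1 i)) ⟨⟨0, hpar.card_pos⟩, Finset.mem_univ _⟩) hn0
  set τ := ε * dualityMeasure z₀ with hτ
  have hτ0 : 0 ≤ τ := (mul_pos hε hμ₀).le
  set M : ℝ := 40000 * Λ ^ 3 * n ^ 2 with hM
  have hM1 : 1 ≤ M := by
    have : (1 : ℝ) ≤ Λ ^ 3 * n ^ 2 :=
      one_le_mul_of_one_le_of_one_le (one_le_pow₀ hpar.one_le) (one_le_pow₀ hn1)
    rw [hM]
    linarith
  have hM0 : 0 < M := zero_lt_one.trans_le hM1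
  have hrate : 0 ≤ 1 - 1 / M := sub_nonneg.mpr ((div_le_one hM0).mpr hM1)
  have hinv : ∀ j ≤ K, Controlled L γ z₀ (z j) ∧
      (dualityMeasure (z j) ≤ τ ∨ dualityMeasure (z j) ≤ (1 - 1 / M) ^ j * dualityMeasure z₀) := by
    intro j
    induction j with
    | zero =>
      intro _
      rw [hinit]
      exact ⟨.of_residuals (η := 1) (neighborhood_subset_closedNeighborhood L γ z₀ hz₀) zero_le_one
        le_rfl (by simp) (by simp), .inr (by simp)⟩
    | succ j ih =>
      intro hj
      obtain ⟨hc, hle⟩ := ih (by omega)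
      obtain ⟨h1, h2, h3⟩ := (hstep j).progress hpar hL h hτ0 hc (hW j hj)
      refine ⟨h1, ?_⟩
      rcases le_or_gt (dualityMeasure (z j)) τ with h4 | h4
      · left
        rwa [h2 h4]
      · right
        have h5 := hle.resolve_left (not_le.mpr h4)
        rw [pow_succ', mul_assoc]
        exact (h3 h4).trans (mul_le_mul_of_nonneg_left h5 hrate)
  obtain ⟨hcK, hK'⟩ := hinv K le_rfl
  have hKτ : dualityMeasure (z K) ≤ τ := by
    refine hK'.elim id fun h1 => h1.trans (mul_le_mul_of_nonneg_right ?_ hμ₀.le)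
    calc (1 - 1 / M) ^ K ≤ Real.exp (-(1 / M)) ^ K :=
          pow_le_pow_left₀ hrate (Real.one_sub_le_exp_neg _) K
      _ = Real.exp (-(K / M)) := by
          rw [← Real.exp_nat_mul]
          congr 1
          ring
      _ ≤ Real.exp (Real.log ε) := by
          refine Real.exp_le_exp.mpr ?_
          have : Real.log (1 / ε) ≤ K / M := by
            rw [le_div_iff₀ hM0]
            linarith
          rw [one_div, Real.log_inv] at this
          linarith
      _ = ε := Real.exp_log hε
  have hstay : z k = z K := by
    induction k, hk using Nat.le_induction with
    | base => rfl
    | succ j _ ih => exact ((hstep j).2 (by rwa [ih])).trans ih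
  rw [hstay]
  refine ⟨hKτ, le_of_mul_le_mul_right ?_ hμ₀⟩
  have hr₀ : 0 ≤ L.resNorm z₀ := Real.sqrt_nonneg _
  -- The residual bound needs no recursion of its own: it is read off from the neighbourhood
  -- condition at the final iterate.
  calc _ ≤ dualityMeasure (z K) * L.resNorm z₀ := hcK.mem.2.2.2
    _ ≤ τ * L.resNorm z₀ := mul_le_mul_of_nonneg_right hKτ hr₀
    _ = _ := by rw [hτ]; ring

end Run

/-! ### Probability of good sketches -/

section Probability

variable {m n w : ℕ}

theorem continuous_l2 {k : ℕ} : Continuous (l2 : (Fin k → ℝ) → ℝ) := by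
  unfold l2
  fun_prop

/-- Closedness supplies Borel measurability although the condition ranges over uncountably many `y`.
-/
theorem isClosed_preserves :
    IsClosed {a : (Fin n → Fin w → ℝ) × (Fin m → Fin n → ℝ) | ∀ y,
      |l2 ((Matrix.of a.2 * Matrix.of a.1)ᵀ *ᵥ y) ^ 2 - l2 ((Matrix.of a.2)ᵀ *ᵥ y) ^ 2| ≤
        1 / 4 * l2 ((Matrix.of a.2)ᵀ *ᵥ y) ^ 2} := by
  rw [Set.ofPred_forall]
  refine isClosed_iInter fun y => ?_
  have h1 : Continuous fun a : (Fin n → Fin w → ℝ) × (Fin m → Fin n → ℝ) =>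
      (Matrix.of a.1 : Matrix (Fin n) (Fin w) ℝ) := continuous_fst
  have h2 : Continuous fun a : (Fin n → Fin w → ℝ) × (Fin m → Fin n → ℝ) =>
      (Matrix.of a.2 : Matrix (Fin m) (Fin n) ℝ) := continuous_snd
  have h3 := (continuous_l2.comp ((h2.matrix_mul h1).matrix_transpose.matrix_mulVec
    (continuous_const (y := y)))).pow 2
  have h4 := (continuous_l2.comp (h2.matrix_transpose.matrix_mulVec
    (continuous_const (y := y)))).pow 2
  exact isClosed_le (h3.sub h4).abs (continuous_const.mul h4)

theorem isClosed_bounded :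
    IsClosed {a : Fin n → Fin w → ℝ | ∀ u,
      l2 ((Matrix.of a)ᵀ *ᵥ u) ^ 2 ≤ 2 * n * l2 u ^ 2} := by
  rw [Set.ofPred_forall]
  refine isClosed_iInter fun u => ?_
  have h1 : Continuous fun a : Fin n → Fin w → ℝ =>
      (Matrix.of a : Matrix (Fin n) (Fin w) ℝ) := continuous_id
  exact isClosed_le ((continuous_l2.comp (h1.matrix_transpose.matrix_mulVec
    (continuous_const (y := u)))).pow 2) continuous_const

theorem measurable_scaledMatrix (L : LinProg m n) :
    Measurable fun z : Point m n => (fun i j => scaledMatrix L z i j : Fin m → Fin n → ℝ) := by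
  refine measurable_pi_iff.mpr fun i => measurable_pi_iff.mpr fun j => ?_
  simp only [scaledMatrix, mul_diagonal]
  have hx : Measurable fun z : Point m n => z.x j :=
    ((continuous_apply j).comp continuous_point_x).measurable
  have hs : Measurable fun z : Point m n => z.s j :=
    ((continuous_apply j).comp continuous_point_s).measurable
  exact measurable_const.mul (hx.div hs).sqrt

/-- Pairs of a sketch and an iterate for which the sketch fails. -/
def badSketch (L : LinProg m n) (w : ℕ) : Set ((Fin n → Fin w → ℝ) × Point m n) :=
  {a | (∀ i, 0 < a.2.x i) ∧ (∀ i, 0 < a.2.s i) ∧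
    ¬ SketchGood (scaledMatrix L a.2) (Matrix.of a.1)}

theorem measurableSet_badSketch (L : LinProg m n) : MeasurableSet (badSketch L w) := by
  have hx : MeasurableSet {a : (Fin n → Fin w → ℝ) × Point m n | ∀ i, 0 < a.2.x i} := by
    rw [Set.ofPred_forall]
    exact MeasurableSet.iInter fun i => measurableSet_lt measurable_const
      ((continuous_apply i).comp (continuous_point_x.comp continuous_snd)).measurable
  have hs : MeasurableSet {a : (Fin n → Fin w → ℝ) × Point m n | ∀ i, 0 < a.2.s i} := by
    rw [Set.ofPred_forall]
    exact MeasurableSet.iInter fun i => measurableSet_lt measurable_const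
      ((continuous_apply i).comp (continuous_point_s.comp continuous_snd)).measurable
  refine hx.inter (hs.inter (MeasurableSet.compl ?_))
  have h1 : Measurable fun a : (Fin n → Fin w → ℝ) × Point m n =>
      (a.1, (fun i j => scaledMatrix L a.2 i j : Fin m → Fin n → ℝ)) :=
    measurable_fst.prodMk ((measurable_scaledMatrix L).comp measurable_snd)
  exact (h1 isClosed_preserves.measurableSet).inter
    (measurable_fst isClosed_bounded.measurableSet)

variable {Ω : Type*} [MeasurableSpace Ω] {P : Measure Ω} [IsProbabilityMeasure P]

/-- The event of an accurate sketch, in the role of `S`, is not shown to be measurable; passing to a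
measurable superset `G` allows complements to be taken. -/
theorem measure_compl_le_of_le_real {S G : Set Ω} {δ : ℝ} (hS : 1 - δ ≤ P.real S) (hSG : S ⊆ G)
    (hG : MeasurableSet G) : P Gᶜ ≤ ENNReal.ofReal δ := by
  rw [← ofReal_measureReal, probReal_compl_eq_one_sub hG]
  refine ENNReal.ofReal_le_ofReal ?_
  linarith [measureReal_mono hSG (μ := P)]

theorem measure_badSketch_section_le {L : LinProg m n} (hL : ∀ y, L.Aᵀ *ᵥ y = 0 → y = 0) {δ : ℝ}
    {W : Ω → Fin n → Fin w → ℝ} (hW : Measurable W)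
    (hsk : IsSketchingMatrix P (1 / 2) δ m fun ω => Matrix.of (W ω)) (z : Point m n) :
    P {ω | (W ω, z) ∈ badSketch L w} ≤ 2 * ENNReal.ofReal δ := by
  by_cases hz : (∀ i, 0 < z.x i) ∧ ∀ i, 0 < z.s i
  swap
  · have : {ω | (W ω, z) ∈ badSketch L w} = ∅ :=
      Set.eq_empty_of_forall_notMem fun ω hω => hz ⟨hω.1, hω.2.1⟩
    rw [this, measure_empty]
    exact zero_le
  set F := scaledMatrix L z with hF
  have hF0 := scaledMatrix_transpose_injective hL hz.1 hz.2
  have hpair : Measurable fun ω => (W ω, (fun i j => F i j : Fin m → Fin n → ℝ)) :=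
    hW.prodMk measurable_const
  set G₁ : Set Ω := {ω | ∀ y, |l2 ((F * Matrix.of (W ω))ᵀ *ᵥ y) ^ 2 - l2 (Fᵀ *ᵥ y) ^ 2| ≤
    1 / 4 * l2 (Fᵀ *ᵥ y) ^ 2}
  set G₂ : Set Ω := {ω | ∀ u, l2 ((Matrix.of (W ω))ᵀ *ᵥ u) ^ 2 ≤ 2 * n * l2 u ^ 2}
  have hG₁ : MeasurableSet G₁ := hpair isClosed_preserves.measurableSet
  have hG₂ : MeasurableSet G₂ := hW isClosed_bounded.measurableSet
  have h1 : P G₁ᶜ ≤ ENNReal.ofReal δ :=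
    measure_compl_le_of_le_real (hsk m (invSqrtGram F * F))
      (fun ω hω y => abs_sub_le_of_sketchAccurate hF0 hω y) hG₁
  have h2 : P G₂ᶜ ≤ ENNReal.ofReal δ :=
    measure_compl_le_of_le_real (hsk n 1)
      (fun ω hω u => l2_transpose_sq_le_of_sketchAccurate hω u) hG₂
  have hsub : {ω | (W ω, z) ∈ badSketch L w} ⊆ G₁ᶜ ∪ G₂ᶜ := by
    intro ω hω
    rw [← Set.compl_inter]
    exact fun h => hω.2.2 ⟨h.1, h.2⟩
  calc _ ≤ P (G₁ᶜ ∪ G₂ᶜ) := measure_mono hsub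
    _ ≤ P G₁ᶜ + P G₂ᶜ := measure_union_le _ _
    _ ≤ ENNReal.ofReal δ + ENNReal.ofReal δ := add_le_add h1 h2
    _ = _ := (two_mul _).symm

/-- By independence the joint law is a product, so Fubini reduces to a fixed iterate, where the
oblivious guarantee applies. -/
theorem measure_badSketch_le {L : LinProg m n} (hL : ∀ y, L.Aᵀ *ᵥ y = 0 → y = 0) {δ : ℝ}
    {W : Ω → Fin n → Fin w → ℝ} {z : Ω → Point m n} (hW : Measurable W) (hz : Measurable z)
    (hsk : IsSketchingMatrix P (1 / 2) δ m fun ω => Matrix.of (W ω)) (hind : IndepFun W z P) :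
    P {ω | (W ω, z ω) ∈ badSketch L w} ≤ 2 * ENNReal.ofReal δ := by
  have hE := measurableSet_badSketch (w := w) L
  have : IsProbabilityMeasure (P.map W) := Measure.isProbabilityMeasure_map hW.aemeasurable
  have : IsProbabilityMeasure (P.map z) := Measure.isProbabilityMeasure_map hz.aemeasurable
  have h1 : P {ω | (W ω, z ω) ∈ badSketch L w} = P.map (fun ω => (W ω, z ω)) (badSketch L w) :=
    (Measure.map_apply (hW.prodMk hz) hE).symm
  rw [h1, (indepFun_iff_map_prod_eq_prod_map_map hW.aemeasurable hz.aemeasurable).mp hind,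
    Measure.prod_apply_symm hE]
  calc _ ≤ ∫⁻ _, 2 * ENNReal.ofReal δ ∂(P.map z) := by
        refine lintegral_mono fun y => ?_
        rw [Measure.map_apply hW (measurable_prodMk_right hE)]
        exact measure_badSketch_section_le hL hW hsk y
    _ = _ := by rw [lintegral_const, measure_univ, mul_one]

end Probability

/-! ### Choice of constants and the main theorem. -/

theorem transpose_mulVec_injective_of_rank {m n : ℕ} {A : Matrix (Fin m) (Fin n) ℝ}
    (h : A.rank = m) (y : Fin m → ℝ) (hy : Aᵀ *ᵥ y = 0) : y = 0 := by
  have h1 : LinearIndependent ℝ A.row := by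
    rw [linearIndependent_iff_card_eq_finrank_span, Fintype.card_fin, Set.finrank,
      ← rank_eq_finrank_span_row, h]
  refine vecMul_injective_iff.mpr h1 ?_
  simp only [zero_vecMul]
  rw [← mulVec_transpose, hy]

/-- With `2 ^ N > 1024 Λ³` and `n + 1 ≥ 2`, the prefactor is at most `(n + 1) ^ (N + 2)`, which
`(3/2) ^ t` exceeds once `t ≥ (N + 2) log (n + 1) / log (3/2)`. -/
theorem steps_suffice {Λ : ℝ} (_ : 0 ≤ Λ) : ∃ T : ℝ, 0 < T ∧ ∀ n t : ℕ, 0 < n →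
    T * Real.log (n + 1) ≤ t → 1024 * n ^ 2 * Λ ^ 3 * (2 / 3 : ℝ) ^ t ≤ 1 := by
  obtain ⟨N, hN⟩ := pow_unbounded_of_one_lt (1024 * Λ ^ 3) one_lt_two
  have hlog : 0 < Real.log (3 / 2) := Real.log_pos (by norm_num)
  refine ⟨(N + 2 : ℕ) / Real.log (3 / 2), div_pos (by positivity) hlog, fun n t hn ht => ?_⟩
  have hn1 : (1 : ℝ) ≤ n := by exact_mod_cast hn
  rw [div_mul_eq_mul_div, div_le_iff₀ hlog, ← Real.log_pow, ← Real.log_pow,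
    Real.log_le_log_iff (by positivity) (by positivity)] at ht
  have h1 : 1024 * Λ ^ 3 * (n : ℝ) ^ 2 ≤ (n + 1 : ℝ) ^ (N + 2) := by
    rw [pow_add]
    have h2 : (2 : ℝ) ^ N ≤ (n + 1) ^ N := pow_le_pow_left₀ zero_le_two (by linarith) N
    have h3 : (n : ℝ) ^ 2 ≤ (n + 1) ^ 2 := pow_le_pow_left₀ (by linarith) (by linarith) 2
    exact mul_le_mul (hN.le.trans h2) h3 (by positivity) (by positivity)
  have h4 : (3 / 2 : ℝ) ^ t * (2 / 3) ^ t = 1 := by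
    rw [← mul_pow]
    norm_num
  calc _ = 1024 * Λ ^ 3 * (n : ℝ) ^ 2 * (2 / 3 : ℝ) ^ t := by ring
    _ ≤ (3 / 2) ^ t * (2 / 3) ^ t := mul_le_mul_of_nonneg_right (h1.trans ht) (by positivity)
    _ = 1 := h4

theorem theorem2 (Λ : ℝ) :
    ∃ C T c : ℝ, 0 < C ∧ 0 < T ∧ 0 < c ∧
      ∀ γ σ : ℝ, 0 < γ → γ < 1 → 0 < σ → σ < 4 / 5 →
        γ⁻¹ ≤ Λ → (1 - γ)⁻¹ ≤ Λ → σ⁻¹ ≤ Λ → (1 - 5 / 4 * σ)⁻¹ ≤ Λ →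
      ∀ (m n w : ℕ) (L : LinProg m n), L.A.rank = m →
      ∀ z₀ : Point m n, z₀ ∈ neighborhood L γ z₀ →
        (∃ zs ∈ L.optimalSet, (∀ i, zs.x i ≤ z₀.x i) ∧ (∀ i, zs.s i ≤ z₀.s i)) →
        (∀ i, |L.c i - (L.Aᵀ *ᵥ z₀.y) i| ≤ z₀.s i) →
      ∀ ε : ℝ, 0 < ε → ε ≤ 1 →
      ∀ δ : ℝ, δ ≤ c / ((n : ℝ) ^ 2 * (1 + Real.log (1 / ε))) →
      ∀ (sv : Solver) (t : ℕ), T * Real.log (n + 1) ≤ t →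
      ∀ {Ω : Type*} [MeasurableSpace Ω] (P : Measure Ω) [IsProbabilityMeasure P]
        (W : ℕ → Ω → Fin n → Fin w → ℝ) (z : ℕ → Ω → Point m n),
        IsInfeasibleIPM P L γ σ (1 / 2) δ (ε * dualityMeasure z₀) sv t z₀ W z →
        0.9 ≤ P.real {ω | ∀ k : ℕ, C * (n : ℝ) ^ 2 * Real.log (1 / ε) ≤ k →
          dualityMeasure (z k ω) ≤ ε * dualityMeasure z₀ ∧
          L.resNorm (z k ω) ≤ ε * L.resNorm z₀} := by
  set Λ' := max Λ 1 with hΛ'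
  have hΛ1 : 1 ≤ Λ' := le_max_right _ _
  have hΛ0 : 0 < Λ' := zero_lt_one.trans_le hΛ1
  obtain ⟨T, hT, hsteps⟩ := steps_suffice hΛ0.le
  set C : ℝ := 40000 * Λ' ^ 3 with hC
  have hC0 : 0 < C := by positivity
  -- The value of `c` makes the union bound `2 K δ` at most `1/10`, using `K ≤ (C + 1) n² (1 + log
  -- (1/ε))`.
  refine ⟨C, T, 1 / (20 * (C + 1)), hC0, hT, by positivity, ?_⟩
  intro γ σ hγ hγ1 hσ hσ1 hγΛ hγΛ' hσΛ _ m n w L hrank z₀ hz₀ hopt hslack ε hε hε1 δ hδ sv t ht Ω _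
    P _ W z hipm
  obtain ⟨zs, hzs, hzx, hzs'⟩ := hopt
  -- For `n = 0` division by zero makes every duality measure `0`, the rank forces `m = 0`, and the
  -- claim is trivial.
  rcases Nat.eq_zero_or_pos n with rfl | hn
  · have hm : m = 0 := Nat.le_zero.mp (hrank ▸ L.A.rank_le_width)
    subst hm
    have hμ : ∀ y : Point 0 0, dualityMeasure y = 0 := fun y => by simp [dualityMeasure]
    have hr : ∀ y : Point 0 0, L.resNorm y = 0 := fun y => by simp [LinProg.resNorm]
    simp only [hμ, hr, mul_zero, le_refl, and_self, implies_true, Set.ofPred_true, probReal_univ]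
    norm_num
  have hL := transpose_mulVec_injective_of_rank hrank
  have hpar : Params Λ' γ σ n t := by
    have hle : Λ ≤ Λ' := le_max_left _ _
    exact ⟨hΛ1, hγ, hγ1, hσ, hσ1, (inv_le_iff_one_le_mul₀ hγ).mp (hγΛ.trans hle),
      (inv_le_iff_one_le_mul₀ (sub_pos.mpr hγ1)).mp (hγΛ'.trans hle),
      (inv_le_iff_one_le_mul₀ hσ).mp (hσΛ.trans hle), hn, hsteps n t hn ht⟩
  set l := Real.log (1 / ε) with hl
  have hl0 : 0 ≤ l := Real.log_nonneg (one_le_one_div hε hε1)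
  have hn1 : (1 : ℝ) ≤ n := by exact_mod_cast hn
  set K : ℕ := ⌈C * (n : ℝ) ^ 2 * l⌉₊ with hK
  set bad : Set Ω := ⋃ k ∈ Finset.range K, {ω | (W k ω, z k ω) ∈ badSketch L w} with hbad
  have hbad_meas : MeasurableSet bad := Finset.measurableSet_biUnion _ fun k _ =>
    ((hipm.measurable_sketch k).prodMk (hipm.measurable_iterate k)) (measurableSet_badSketch L)
  have hbad_le : P bad ≤ ENNReal.ofReal (1 / 10) := by
    calc P bad ≤ ∑ k ∈ Finset.range K, P {ω | (W k ω, z k ω) ∈ badSketch L w} :=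
          measure_biUnion_finset_le _ _
      _ ≤ ∑ _k ∈ Finset.range K, 2 * ENNReal.ofReal δ := Finset.sum_le_sum fun k _ =>
          measure_badSketch_le hL (hipm.measurable_sketch k) (hipm.measurable_iterate k)
            (hipm.sketch k) (hipm.indep k)
      _ = ENNReal.ofReal (2 * K * δ) := by
          rw [Finset.sum_const, Finset.card_range, nsmul_eq_mul,
            ENNReal.ofReal_mul (by positivity), ENNReal.ofReal_mul (by positivity),
            ENNReal.ofReal_natCast, ENNReal.ofReal_ofNat]
          ring
      _ ≤ ENNReal.ofReal (1 / 10) := by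
          refine ENNReal.ofReal_le_ofReal ?_
          -- The summand `1` next to the logarithm absorbs the rounding up in `K`.
          have hKle : (K : ℝ) ≤ (C + 1) * (n ^ 2 * (1 + l)) := by
            have h1 : (K : ℝ) < C * (n : ℝ) ^ 2 * l + 1 := Nat.ceil_lt_add_one (by positivity)
            have h2 : (1 : ℝ) ≤ n ^ 2 * (1 + l) :=
              one_le_mul_of_one_le_of_one_le (one_le_pow₀ hn1) (by linarith)
            have h3 : 0 ≤ C * (n : ℝ) ^ 2 := by positivity
            linarith
          have hden : (0 : ℝ) < n ^ 2 * (1 + l) := by positivity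
          calc 2 * K * δ ≤ 2 * K * (1 / (20 * (C + 1)) / (n ^ 2 * (1 + l))) :=
                mul_le_mul_of_nonneg_left hδ (by positivity)
            _ ≤ 2 * ((C + 1) * (n ^ 2 * (1 + l))) * (1 / (20 * (C + 1)) / (n ^ 2 * (1 + l))) := by
                gcongr
            _ = 1 / 10 := by
                field_simp
                norm_num
  have hreal : 1 - 1 / 10 ≤ P.real badᶜ := by
    rw [probReal_compl_eq_one_sub hbad_meas]
    have : P.real bad ≤ 1 / 10 := ENNReal.toReal_le_of_le_ofReal (by norm_num) hbad_le
    linarith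
  refine (by norm_num : (0.9 : ℝ) ≤ 1 - 1 / 10).trans (hreal.trans (measureReal_mono ?_))
  intro ω hω k hk
  refine run_converges hpar hL ⟨hzs, hzx, hzs', hslack⟩ hz₀ hε (hipm.init ω)
    (fun j => hipm.step j ω) (fun j hj hx hs => ?_) (Nat.le_ceil _) (Nat.ceil_le.mpr hk)
  by_contra hnot
  exact hω (Set.mem_biUnion (Finset.mem_coe.mpr (Finset.mem_range.mpr hj)) ⟨hx, hs, hnot⟩)
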